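/- Let $d\ge 2$ and $q\ge 2$ be integers, let $\Lambda=\prod_{i=1}^d[a_i,b_i)\subset\mathbb R^d$ with $a_i<b_i$ be a rectangular box with periodic boundary conditions, and let $z>0$, $T\ge 0$. A configuration is a $q$-tuple $\mathbf X=(X_1,\dots,X_q)$ of pairwise disjoint finite subsets of $\Lambda$ ($X_a$ being the set of positions of the particles of type $a$); the space of configurations carries the $\sigma$-algebra generated by the counts $\#(X_a\cap B)$, $B\subset\Lambda$ Borel. Let $\varphi(x-y)=1$ if $|x-y|\le 1$ and $\varphi(x-y)=0$ otherwise, where $x-y$ is understood modulo $\Lambda$ (that is, $|\cdot|$ is the Euclidean distance on the torus), and let $H_\Lambda(\mathbf X)=\sum_{1\le a<b\le q}\sum_{x\in X_a,\,y\in X_b}\varphi(x-y)$. The finite-volume continuum Potts Gibbs measure is $$\mu_{\Lambda,z,T}(d\mathbf X)=Z_{\Lambda,z,T}^{-1}\,e^{-H_\Lambda(\mathbf X)/T}\prod_{a=1}^q z^{\#X_a}L_\Lambda(dX_a),\qquad L_\Lambda(A)=\sum_{n\ge0}\frac1{n!}\int_{\Lambda^n}1_A(\{x_1,\dots,x_n\})\,dx_1\cdots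 dx_n,$$ where $Z_{\Lambda,z,T}$ is the normalizing constant and, for $T=0$, $e^{-h/T}$ means $1$ if $h=0$ and $0$ if $h>0$. One sweep of the continuum Swendsen–Wang algorithm changes a configuration $\mathbf X$ by the following three steps. (1) Successively for $a=1,\dots,q$, replace $X_a$ by a sample of the Poisson point process on $\Lambda$ with intensity function $x\mapsto z\exp[-\sum_{y\in X_b,\,b\ne a}\varphi(x-y)/T]$. (2) Independently for each pair $\{x,y\}$ of distinct points of the same type, draw an edge between $x$ and $y$ with probability $1-e^{-\varphi(x-y)/T}$. (3) For each cluster (connected component) of the resulting graph on $X=\bigcup_aX_a$, independently, choose a type uniformly in $\{1,\dots,q\}$ and assign it to all points of the cluster. Then $\mu_{\Lambda,z,T}$ is a probability measure, the sweep is a Markov transition kernel on the space of configurations, and $\mu_{\Lambda,z,T}$ is invariant under it. Moreover, if $\mathbf X_n$ denotes the configuration after $n$ sweeps, then the law of $\mathbf X_n$ converges to $\mu_{\Lambda,z,T}$ in total variation norm at a geometric rate, uniformly in the (deterministic or random) initial configuration: for every initial law and every $n\ge0$, $$\bigl\|\mathrm{Law}(\mathbf X_n)-\mu_{\Lambda,z,T}\bigr\|_{TV}\le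 2\,\bigl(1-e^{-zq|\Lambda|}\bigr)^n,$$ where $\|\cdot\|_{TV}$ is the total mass of the variation of a signed measure and $|\Lambda|$ the volume of $\Lambda$. -/

import Mathlib

open MeasureTheory
open scoped ENNReal

noncomputable section

namespace ContinuumPotts

/-- The finite subsets of `α`. (A separate type, since `Finset α` already carries a coarser
`σ`-algebra.) -/
@[ext]
structure FiniteSubset (α : Type*) where
  /-- the points -/
  pts : Finset α

/-- The counting `σ`-algebra on the finite subsets of a measurable space: the smallest one that
makes `X ↦ #(X ∩ B)` measurable for every measurable `B`. -/
instance instMeasurableSpaceFiniteSubset {α : Type*} [MeasurableSpace α] :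
    MeasurableSpace (FiniteSubset α) :=
  ⨆ B : {B : Set α // MeasurableSet B},
    MeasurableSpace.comap (fun X : FiniteSubset α => ((X.pts : Set α) ∩ B.1).ncard) ⊤

variable {d q : ℕ}

/-- The rectangular box with lower corner `a` and upper corner `b`; it is half-open because it is
a fundamental domain for the periodic boundary condition. -/
def box (a b : Fin d → ℝ) : Set (EuclideanSpace ℝ (Fin d)) :=
  {x | ∀ i, x i ∈ Set.Ico (a i) (b i)}

/-- `|x - y| ≤ 1`, the difference being understood modulo the box (torus distance). -/
def PeriodicClose (a b : Fin d → ℝ) (x y : EuclideanSpace ℝ (Fin d)) : Prop :=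
  ∃ k : Fin d → ℤ, ‖x - y + WithLp.toLp 2 (fun i => (k i : ℝ) * (b i - a i))‖ ≤ 1

theorem PeriodicClose.symm {a b : Fin d → ℝ} {x y : EuclideanSpace ℝ (Fin d)}
    (h : PeriodicClose a b x y) : PeriodicClose a b y x := by
  obtain ⟨k, hk⟩ := h
  refine ⟨fun i => -k i, ?_⟩
  rw [← norm_neg]
  have h : -(y - x + WithLp.toLp 2 (fun i => ((-k i : ℤ) : ℝ) * (b i - a i))) =
      x - y + WithLp.toLp 2 (fun i => (k i : ℝ) * (b i - a i)) := by
    ext i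
    simp
    ring
  rwa [h]

variable {a b : Fin d → ℝ}

open scoped Classical in
/-- The step potential `φ(x - y)` with periodic boundary condition. -/
def potential (x y : box a b) : ℝ :=
  if PeriodicClose a b x.1 y.1 then 1 else 0

theorem potential_comm (x y : box a b) : potential x y = potential y x := by
  have h : PeriodicClose a b x.1 y.1 ↔ PeriodicClose a b y.1 x.1 :=
    ⟨PeriodicClose.symm, PeriodicClose.symm⟩
  by_cases hxy : PeriodicClose a b x.1 y.1
  · simp [potential, hxy, h.1 hxy]
  · simp [potential, hxy, mt h.2 hxy]

open scoped Classical in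
/-- The Boltzmann factor `exp (-h / T)` of an energy `h ≥ 0`; at temperature `T = 0` it is the
hard-core limit, that is `1` if `h = 0` and `0` if `h > 0`. -/
def boltzmann (T h : ℝ) : ℝ :=
  if T = 0 then (if h = 0 then 1 else 0) else Real.exp (-h / T)

/-- Particle configurations: `q`-tuples of pairwise disjoint finite subsets of the box, with the
`σ`-algebra inherited from the product. -/
abbrev Config (q : ℕ) (a b : Fin d → ℝ) : Type :=
  {c : Fin q → FiniteSubset (box a b) // Pairwise fun s t => Disjoint (c s).pts (c t).pts}

/-- The Hamiltonian: the interaction energy of the pairs of particles of different types. -/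
def hamiltonian (c : Config q a b) : ℝ :=
  ∑ s : Fin q, ∑ t ∈ Finset.Ioi s, ∑ x ∈ (c.1 s).pts, ∑ y ∈ (c.1 t).pts, potential x y

/-- Lebesgue measure on the box. -/
def boxVolume (a b : Fin d → ℝ) : Measure (box a b) :=
  Measure.comap Subtype.val volume

open scoped Classical in
/-- The Lebesgue–Poisson measure on the finite subsets of the box:
`A ↦ ∑ n, (1 / n!) ∫ 1_A {x₁, …, xₙ} dx₁ ⋯ dxₙ`. -/
def lebesguePoisson (a b : Fin d → ℝ) : Measure (FiniteSubset (box a b)) :=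
  Measure.sum fun n : ℕ =>
    ((n.factorial : ℝ≥0∞)⁻¹) •
      (Measure.pi fun _ : Fin n => boxVolume a b).map
        (fun x => ⟨Finset.univ.image x⟩)

/-- `exp (-H / T) ∏ z ^ #X_s L(dX_s)`, before normalization. -/
def gibbsUnnormalized (q : ℕ) (a b : Fin d → ℝ) (z T : ℝ) : Measure (Config q a b) :=
  ((Measure.pi fun _ : Fin q => lebesguePoisson a b).comap Subtype.val).withDensity
    fun c => ENNReal.ofReal (boltzmann T (hamiltonian c) * ∏ s, z ^ (c.1 s).pts.card)

/-- The continuum Potts Gibbs distribution in the box. -/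
def gibbs (q : ℕ) (a b : Fin d → ℝ) (z T : ℝ) : Measure (Config q a b) :=
  (gibbsUnnormalized q a b z T Set.univ)⁻¹ • gibbsUnnormalized q a b z T

/-- The Poisson point process on the box with intensity function `u`. -/
def poissonProcess (u : box a b → ℝ) : Measure (FiniteSubset (box a b)) :=
  ENNReal.ofReal (Real.exp (-∫ x, u x ∂(boxVolume a b))) •
    (lebesguePoisson a b).withDensity fun X => ENNReal.ofReal (∏ x ∈ X.pts, u x)

open scoped Classical in
/-- The positions of the particles whose type is not `s`. -/
def otherTypes (s : Fin q) (c : Config q a b) : Finset (box a b) :=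
  (Finset.univ.filter (· ≠ s)).biUnion fun t => (c.1 t).pts

/-- The replacement of the particles of type `s` by a sample of the Poisson process with
intensity `z p(· | X_{≠ s})`. The new tuple is almost surely pairwise disjoint; `comap` regards
its law as a measure on the space of configurations. -/
def resampleType (z T : ℝ) (s : Fin q) (c : Config q a b) : Measure (Config q a b) :=
  ((poissonProcess fun x => z * boltzmann T (∑ y ∈ otherTypes s c, potential x y)).map
    (fun Y => Function.update c.1 s Y)).comap Subtype.val

/-- First step of a sweep: the types are resampled successively, in increasing order. -/
def resamplePositions (z T : ℝ) (c : Config q a b) : Measure (Config q a b) :=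
  (List.finRange q).foldl (fun ν s => ν.bind (resampleType z T s)) (Measure.dirac c)

open scoped Classical in
/-- The set of all occupied positions. -/
def positions (c : Config q a b) : Finset (box a b) :=
  Finset.univ.biUnion fun s => (c.1 s).pts

open scoped Classical in
/-- The pairs of distinct particles of the same type. -/
def sameTypePairs (c : Config q a b) : Finset (Sym2 (positions c)) :=
  Finset.univ.filter fun e => ¬ e.IsDiag ∧ ∃ s, ∀ x ∈ e, x.1 ∈ (c.1 s).pts

/-- The probability `p(x - y) = 1 - exp (-φ(x - y) / T)` of an edge. -/
def edgeProb (T : ℝ) {X : Finset (box a b)} (e : Sym2 X) : ℝ :=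
  Sym2.lift ⟨fun x y : X => 1 - boltzmann T (potential x.1 y.1),
    fun x y => by simp only [potential_comm x.1 y.1]⟩ e

open scoped Classical in
/-- The probability that the second step of a sweep, which draws the edges between particles of
the same type independently, produces the edge set `E ⊆ sameTypePairs c`. -/
def edgeSetProb (T : ℝ) (c : Config q a b) (E : Finset (Sym2 (positions c))) : ℝ :=
  (∏ e ∈ E, edgeProb T e) * ∏ e ∈ sameTypePairs c \ E, (1 - edgeProb T e)

open scoped Classical in
/-- The configuration in which each vertex of the graph `G` on the finite set `X` has the type
that `κ` attaches to its cluster. -/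
def colorClusters {X : Finset (box a b)} (G : SimpleGraph X)
    (κ : G.ConnectedComponent → Fin q) : Config q a b :=
  ⟨fun s => ⟨(Finset.univ.filter fun x : X => κ (G.connectedComponentMk x) = s).map
      (Function.Embedding.subtype _)⟩, by
    intro s t hst
    dsimp only
    rw [Finset.disjoint_map, Finset.disjoint_filter]
    intro x _ hs ht
    exact hst (hs.symm.trans ht)⟩

open scoped Classical in
/-- Third step of a sweep: independent uniform types for the clusters of the graph `G`. -/
def chooseTypes (q : ℕ) {X : Finset (box a b)} (G : SimpleGraph X) : Measure (Config q a b) :=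
  ∑ κ : G.ConnectedComponent → Fin q,
    ((q : ℝ≥0∞)⁻¹) ^ Fintype.card G.ConnectedComponent • Measure.dirac (colorClusters G κ)

/-- Second and third step of a sweep: draw edges, then choose the types of the clusters. -/
def drawEdgesAndChooseTypes (T : ℝ) (c : Config q a b) : Measure (Config q a b) :=
  ∑ E ∈ (sameTypePairs c).powerset,
    ENNReal.ofReal (edgeSetProb T c E) •
      chooseTypes q (SimpleGraph.fromEdgeSet (E : Set (Sym2 (positions c))))

/-- The transition law of one sweep of the continuum Swendsen–Wang algorithm. -/
def sweep (z T : ℝ) (c : Config q a b) : Measure (Config q a b) :=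
  (resamplePositions z T c).bind (drawEdgesAndChooseTypes T)

/-- The law of the configuration after `n` sweeps, when the initial one has law `ν`. -/
def lawAfter (z T : ℝ) (ν : Measure (Config q a b)) (n : ℕ) : Measure (Config q a b) :=
  (fun ρ => ρ.bind (sweep z T))^[n] ν

open scoped Classical in
/-- The total variation norm `|ρ - ν|(Ω)` of the difference of two finite measures (and `∞` if
one of the measures is not finite). -/
def tvNorm {Ω : Type*} [MeasurableSpace Ω] (ρ ν : Measure Ω) : ℝ≥0∞ :=
  if h : IsFiniteMeasure ρ ∧ IsFiniteMeasure ν then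
    haveI := h.1
    haveI := h.2
    (ρ.toSignedMeasure - ν.toSignedMeasure).totalVariation Set.univ
  else ∞

end ContinuumPotts

end

/-! The convergence is Doeblin's argument with the empty configuration as regeneration state.
Whatever the other types do, the conditional intensity of one type is at most `z`, so its Poisson
sample is empty with probability at least `exp (-z|Λ|)` (`le_resampleType`). Emptying the `q` types
one after another has probability at least `ε = exp (-zq|Λ|)`, and edges and recoloring leave the
empty configuration alone, so a sweep dominates `ε` times the point mass there, uniformly in the
start (`smul_dirac_le_sweep`). Run the chain from `ν` and from the Gibbs measure: at each sweep a
fraction `ε` of what still differs is moved to a common part, so after `n` sweeps the two laws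
differ by measures of mass `(1 - ε) ^ n` each (`exists_common_part`). The factor `2` is the sum of
these two masses.

Invariance is checked separately for the two kinds of moves. Resampling a type is a heat-bath step:
the Gibbs weight is the weight without type `s` times the product of the conditional intensities
over the points of type `s` (`gibbsWeight_eq_mul`), so the conditional law of that type is the
Poisson process being sampled.

For edges and recoloring, the product of `q` Lebesgue–Poisson measures is rewritten as an integral
over unlabelled positions of a sum over all colorings (`pi_lebesguePoisson`; the combinatorial
content is the multinomial theorem). For fixed positions there remains the finite Edwards–Sokal
identity `sum_edwardsSokal`: Potts weight times edge probability is a random-cluster weight that no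
longer sees the coloring.

The kernels must also be measurable for the counting `σ`-algebra. This rests on a measurable
enumeration of the points of a finite set (`measurable_nthPoint`), which reduces functions of a
finite set to functions of tuples. -/

noncomputable section

namespace ContinuumPotts

open scoped Classical

/-! ### Measurability on the space of finite subsets -/

section FiniteSubset

variable {α β : Type*}

/-- The finite set of the values of a finite family of points. -/
def ofTuple {ι : Type*} [Fintype ι] (x : ι → α) : FiniteSubset α := ⟨Finset.univ.image x⟩

theorem prod_ofTuple {ι M : Type*} [Fintype ι] [CommMonoid M] {x : ι → α}
    (hx : Function.Injective x) (f : α → M) : ∏ y ∈ (ofTuple x).pts, f y = ∏ i, f (x i) :=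
  Finset.prod_image fun _ _ _ _ hij => hx hij

theorem card_ofTuple {ι : Type*} [Fintype ι] {x : ι → α} (hx : Function.Injective x) :
    (ofTuple x).pts.card = Fintype.card ι :=
  Finset.card_image_of_injective _ hx

variable [MeasurableSpace α] [MeasurableSpace β]

theorem measurable_count {B : Set α} (hB : MeasurableSet B) :
    Measurable fun X : FiniteSubset α => ((X.pts : Set α) ∩ B).ncard := by
  apply Measurable.of_comap_le
  exact le_iSup (fun B : {B : Set α // MeasurableSet B} =>
    MeasurableSpace.comap (fun X : FiniteSubset α => ((X.pts : Set α) ∩ B.1).ncard) ⊤) ⟨B, hB⟩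

theorem measurable_of_count {f : β → FiniteSubset α}
    (h : ∀ B, MeasurableSet B → Measurable fun y => (((f y).pts : Set α) ∩ B).ncard) :
    Measurable f := by
  apply Measurable.of_le_map
  refine iSup_le fun B => ?_
  rintro s ⟨t, -, rfl⟩
  exact h B.1 B.2 (MeasurableSpace.measurableSet_top (s := t))

theorem measurable_card : Measurable fun X : FiniteSubset α => X.pts.card := by
  simpa [Set.ncard_coe_finset] using measurable_count (α := α) MeasurableSet.univ

theorem measurableSet_pts_eq_empty :
    MeasurableSet {X : FiniteSubset α | X.pts = ∅} := by
  have := measurable_card (α := α) (measurableSet_singleton 0)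
  convert this using 1
  ext X; simp

variable [StandardBorelSpace α]

/-- Adjoining `x i` raises the count in `B` by one exactly when `x i` lies in `B` and is not a
repetition; repetitions form a measurable event because the diagonal of a standard Borel space is
measurable. -/
theorem measurable_image {ι : Type*} (s : Finset ι) :
    Measurable fun x : ι → α => (⟨s.image x⟩ : FiniteSubset α) := by
  induction s using Finset.induction_on with
  | empty => simp
  | insert i s hi ih =>
    apply measurable_of_count
    intro B hB
    have hmem : MeasurableSet {x : ι → α | x i ∈ s.image x} := by
      have : {x : ι → α | x i ∈ s.image x} = ⋃ j ∈ s, {x | x j = x i} := by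
        ext x; simp
      rw [this]
      exact s.measurableSet_biUnion fun j _ =>
        measurableSet_eq_fun (measurable_pi_apply j) (measurable_pi_apply i)
    have hB' : MeasurableSet {x : ι → α | x i ∈ B} := measurable_pi_apply i hB
    have key : (fun x : ι → α => (((insert i s).image x : Finset α) ∩ B : Set α).ncard) =
        fun x => ((s.image x : Finset α) ∩ B : Set α).ncard +
          if x i ∈ B ∧ x i ∉ s.image x then 1 else 0 := by
      funext x
      rw [Finset.image_insert, Finset.coe_insert]
      by_cases h1 : x i ∈ B
      · rw [Set.insert_inter_of_mem h1]
        by_cases h2 : x i ∈ s.image x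
        · rw [Set.insert_eq_of_mem (Set.mem_inter (Finset.mem_coe.2 h2) h1)]
          simp only [h2, not_true, and_false, if_false, add_zero]
        · rw [Set.ncard_insert_of_notMem (fun h => h2 h.1)
            ((Finset.finite_toSet _).inter_of_left _), if_pos ⟨h1, h2⟩]
      · rw [Set.insert_inter_of_notMem h1, if_neg (fun h => h1 h.1), add_zero]
    rw [key]
    exact ((measurable_count hB).comp ih).add
      (Measurable.ite (hB'.inter hmem.compl) measurable_const measurable_const)

theorem measurable_ofTuple {ι : Type*} [Fintype ι] :
    Measurable (ofTuple : (ι → α) → FiniteSubset α) := measurable_image Finset.univ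

/-- Translates the location of the `k`-th smallest point (counted from `0`) into a number of points
in a half-line, that is, into the kind of function that generates the `σ`-algebra. -/
theorem orderEmbOfFin_le_iff {s : Finset ℝ} {n : ℕ} (h : s.card = n) (k : Fin n) (t : ℝ) :
    s.orderEmbOfFin h k ≤ t ↔ (k : ℕ) < (s.filter (· ≤ t)).card := by
  constructor
  · intro hk
    have hsub : (Finset.Iic k).map (s.orderEmbOfFin h).toEmbedding ⊆ s.filter (· ≤ t) := by
      intro y hy
      obtain ⟨i, hi, rfl⟩ := Finset.mem_map.1 hy
      refine Finset.mem_filter.2 ⟨s.orderEmbOfFin_mem h i, ?_⟩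
      exact ((s.orderEmbOfFin h).monotone (Finset.mem_Iic.1 hi)).trans hk
    have := Finset.card_le_card hsub
    rw [Finset.card_map, Fin.card_Iic] at this
    omega
  · intro hk
    by_contra! hlt
    have hsub : s.filter (· ≤ t) ⊆ (Finset.Iio k).map (s.orderEmbOfFin h).toEmbedding := by
      intro y hy
      obtain ⟨hys, hyt⟩ := Finset.mem_filter.1 hy
      have : y ∈ Set.range (s.orderEmbOfFin h) := by rw [Finset.range_orderEmbOfFin]; exact hys
      obtain ⟨i, rfl⟩ := this
      refine Finset.mem_map_of_mem _ (Finset.mem_Iio.2 ?_)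
      exact (s.orderEmbOfFin h).lt_iff_lt.1 (hyt.trans_lt hlt)
    have := Finset.card_le_card hsub
    rw [Finset.card_map, Fin.card_Iio] at this
    omega

theorem injective_embeddingReal : Function.Injective (embeddingReal α) :=
  (measurableEmbedding_embeddingReal α).injective

theorem card_image_embeddingReal (X : Finset α) : (X.image (embeddingReal α)).card = X.card :=
  Finset.card_image_of_injective _ injective_embeddingReal

variable [Nonempty α]

/-- The points of a finite subset of a standard Borel space, listed in the order that is induced
by an embedding into the real line (and an arbitrary point beyond the last one). -/
def nthPoint (X : FiniteSubset α) (k : ℕ) : α :=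
  if h : k < X.pts.card then
    Function.invFun (embeddingReal α)
      ((X.pts.image (embeddingReal α)).orderEmbOfFin (card_image_embeddingReal X.pts) ⟨k, h⟩)
  else Classical.arbitrary α

theorem embeddingReal_nthPoint {X : FiniteSubset α} {k : ℕ} (h : k < X.pts.card) :
    embeddingReal α (nthPoint X k) =
      (X.pts.image (embeddingReal α)).orderEmbOfFin (card_image_embeddingReal X.pts) ⟨k, h⟩ := by
  rw [nthPoint, dif_pos h]
  apply Function.invFun_eq
  obtain ⟨y, -, hy⟩ := Finset.mem_image.1 ((X.pts.image (embeddingReal α)).orderEmbOfFin_mem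
    (card_image_embeddingReal X.pts) ⟨k, h⟩)
  exact ⟨y, hy⟩

theorem measurable_nthPoint (k : ℕ) : Measurable fun X : FiniteSubset α => nthPoint X k := by
  rw [← (measurableEmbedding_embeddingReal α).measurable_comp_iff]
  refine measurable_of_Iic fun t => ?_
  -- The first part covers an existing `k`-th point, the second the default value used when there
  -- are too few points.
  have : (embeddingReal α ∘ fun X : FiniteSubset α => nthPoint X k) ⁻¹' Set.Iic t =
      ({X | k < X.pts.card} ∩
        {X | k < ((X.pts : Set α) ∩ embeddingReal α ⁻¹' Set.Iic t).ncard}) ∪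
      ({X | X.pts.card ≤ k} ∩ {_X | embeddingReal α (Classical.arbitrary α) ≤ t}) := by
    ext X
    by_cases h : k < X.pts.card
    · have e : ((X.pts : Set α) ∩ embeddingReal α ⁻¹' Set.Iic t).ncard =
          ((X.pts.image (embeddingReal α)).filter (· ≤ t)).card := by
        rw [Finset.filter_image, Finset.card_image_of_injective _ injective_embeddingReal,
          ← Set.ncard_coe_finset]
        congr 1
        ext y; simp
      simp only [Set.mem_preimage, Function.comp, embeddingReal_nthPoint h, Set.mem_Iic,
        orderEmbOfFin_le_iff, ← e]
      simp [h]
    · simp [nthPoint, h, not_lt.1 h]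
  rw [this]
  have h1 := measurable_card (α := α)
  refine ((h1 measurableSet_Ioi).inter ?_).union ((h1 measurableSet_Iic).inter (.const _))
  exact (measurable_count ((measurableEmbedding_embeddingReal α).measurable measurableSet_Iic))
    (measurableSet_Ioi (a := k))

theorem injective_nthPoint {X : FiniteSubset α} {n : ℕ} (h : X.pts.card = n) :
    Function.Injective fun i : Fin n => nthPoint X i := by
  subst h
  intro i j hij
  have := congrArg (embeddingReal α) hij
  simp only [embeddingReal_nthPoint i.2, embeddingReal_nthPoint j.2] at this
  simpa using this

theorem ofTuple_nthPoint {X : FiniteSubset α} {n : ℕ} (h : X.pts.card = n) :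
    ofTuple (fun i : Fin n => nthPoint X i) = X := by
  have hinj := injective_nthPoint h
  subst h
  ext1
  refine Finset.eq_of_subset_of_card_le ?_ ?_
  · intro y hy
    obtain ⟨i, -, rfl⟩ := Finset.mem_image.1 hy
    have : embeddingReal α (nthPoint X i) ∈ X.pts.image (embeddingReal α) := by
      rw [embeddingReal_nthPoint i.2]; exact Finset.orderEmbOfFin_mem _ _ _
    obtain ⟨y, hy, hyx⟩ := Finset.mem_image.1 this
    rwa [← injective_embeddingReal hyx]
  · rw [ofTuple, Finset.card_image_of_injective _ hinj]; simp

theorem exists_nthPoint_eq {X : FiniteSubset α} {x : α} :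
    x ∈ X.pts ↔ ∃ k < X.pts.card, nthPoint X k = x := by
  conv_lhs => rw [← ofTuple_nthPoint (X := X) rfl]
  simp only [ofTuple, Finset.mem_image, Finset.mem_univ, true_and]
  exact ⟨fun ⟨i, hi⟩ => ⟨i, i.2, hi⟩, fun ⟨k, hk, h⟩ => ⟨⟨k, hk⟩, h⟩⟩

/-- A function of a parameter and a finite subset is measurable if it is a measurable function
of the parameter and the points, for each number of points. -/
theorem measurable_of_tuple {W : Type*} [MeasurableSpace W] {g : W × FiniteSubset α → β}
    (G : ∀ n : ℕ, W × (Fin n → α) → β) (hG : ∀ n, Measurable (G n))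
    (h : ∀ n w (x : Fin n → α), Function.Injective x → g (w, ofTuple x) = G n (w, x)) :
    Measurable g := by
  intro S hS
  have : g ⁻¹' S = ⋃ n : ℕ, {p | p.2.pts.card = n} ∩
      {p | G n (p.1, fun i => nthPoint p.2 i) ∈ S} := by
    ext ⟨w, X⟩
    simp only [Set.mem_preimage, Set.mem_iUnion, Set.mem_inter_iff, Set.mem_ofPred_eq]
    rw [exists_eq_left', ← h _ _ _ (injective_nthPoint rfl), ofTuple_nthPoint rfl]
  rw [this]
  refine MeasurableSet.iUnion fun n => MeasurableSet.inter ?_ ?_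
  · exact (measurable_card.comp measurable_snd) (measurableSet_singleton n)
  · refine (hG n).comp (measurable_fst.prodMk ?_) hS
    exact measurable_pi_lambda _ fun i => (measurable_nthPoint i).comp measurable_snd

theorem measurable_sum_pts {W M : Type*} [MeasurableSpace W] [AddCommMonoid M]
    [MeasurableSpace M] [MeasurableAdd₂ M] {f : W × α → M} (hf : Measurable f) :
    Measurable fun p : W × FiniteSubset α => ∑ y ∈ p.2.pts, f (p.1, y) := by
  refine measurable_of_tuple (fun n p => ∑ i : Fin n, f (p.1, p.2 i)) (fun n => ?_) ?_
  · refine Finset.measurable_sum _ fun i _ => hf.comp ?_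
    exact measurable_fst.prodMk ((measurable_pi_apply i).comp measurable_snd)
  · intro n w x hx
    simp only [ofTuple]
    exact Finset.sum_image fun i _ j _ hij => hx hij

theorem measurable_prod_pts {W M : Type*} [MeasurableSpace W] [CommMonoid M]
    [MeasurableSpace M] [MeasurableMul₂ M] {f : W × α → M} (hf : Measurable f) :
    Measurable fun p : W × FiniteSubset α => ∏ y ∈ p.2.pts, f (p.1, y) := by
  refine measurable_of_tuple (fun n p => ∏ i : Fin n, f (p.1, p.2 i)) (fun n => ?_) ?_
  · refine Finset.measurable_prod _ fun i _ => hf.comp ?_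
    exact measurable_fst.prodMk ((measurable_pi_apply i).comp measurable_snd)
  · intro n w x hx
    exact prod_ofTuple hx _

/-- With the enumeration, disjointness is a countable family of conditions that two enumerated
points do not coincide. -/
theorem measurableSet_disjoint :
    MeasurableSet {p : FiniteSubset α × FiniteSubset α | Disjoint p.1.pts p.2.pts} := by
  have : {p : FiniteSubset α × FiniteSubset α | Disjoint p.1.pts p.2.pts} =
      ⋂ i : ℕ, ⋂ j : ℕ, ({p | i < p.1.pts.card} ∩ {p | j < p.2.pts.card} ∩
        {p | nthPoint p.1 i = nthPoint p.2 j})ᶜ := by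
    ext ⟨X, Y⟩
    simp only [Set.mem_ofPred_eq, Finset.disjoint_left, exists_nthPoint_eq, Set.mem_iInter,
      Set.mem_compl_iff, Set.mem_inter_iff]
    constructor
    · rintro h i j ⟨⟨hi, hj⟩, hij⟩
      exact h ⟨i, hi, rfl⟩ ⟨j, hj, hij.symm⟩
    · rintro h _ ⟨i, hi, rfl⟩ ⟨j, hj, hij⟩
      exact h i j ⟨⟨hi, hj⟩, hij.symm⟩
  rw [this]
  refine MeasurableSet.iInter fun i => MeasurableSet.iInter fun j => MeasurableSet.compl ?_
  refine MeasurableSet.inter (MeasurableSet.inter ?_ ?_) ?_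
  · exact (measurable_card.comp measurable_fst) (measurableSet_Ioi (a := i))
  · exact (measurable_card.comp measurable_snd) (measurableSet_Ioi (a := j))
  · exact measurableSet_eq_fun ((measurable_nthPoint i).comp measurable_fst)
      ((measurable_nthPoint j).comp measurable_snd)

end FiniteSubset

/-! ### Product measures -/

section ProductMeasure

variable {α : Type*} [MeasurableSpace α]

theorem lintegral_pi_prod_eq_pow (μ : Measure α) [SigmaFinite μ] {u : α → ℝ≥0∞}
    (hu : Measurable u) (n : ℕ) :
    ∫⁻ x : Fin n → α, ∏ i, u (x i) ∂Measure.pi (fun _ => μ) = (∫⁻ y, u y ∂μ) ^ n := by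
  induction n with
  | zero => simp
  | succ n ih =>
    have h := (measurePreserving_piFinSuccAbove (fun _ : Fin (n + 1) => μ) 0).symm
    rw [h.lintegral_map_equiv]
    have e : ∀ p : α × (Fin n → α), ∏ i, u ((MeasurableEquiv.piFinSuccAbove
        (fun _ : Fin (n + 1) => α) 0).symm p i) = u p.1 * ∏ i, u (p.2 i) := by
      intro p
      rw [Fin.prod_univ_succ]
      rfl
    simp_rw [e]
    have hv : Measurable fun x : Fin n → α => ∏ i, u (x i) :=
      Finset.measurable_prod _ fun i _ => hu.comp (measurable_pi_apply i)
    rw [pow_succ', ← ih]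
    exact lintegral_prod_mul hu.aemeasurable hv.aemeasurable

/-- Integrating out the coordinate `i` alone, the set `x i = x j` has the singleton `{x j}` as its
section, which is null. -/
theorem ae_pi_injective [StandardBorelSpace α] {ι : Type*} [Fintype ι] (μ : Measure α)
    [SigmaFinite μ] [NullSingletonClass μ] :
    ∀ᵐ x : ι → α ∂Measure.pi (fun _ => μ), Function.Injective x := by
  have key : ∀ i j : ι, i ≠ j → ∀ᵐ x : ι → α ∂Measure.pi (fun _ => μ), x i ≠ x j := by
    intro i j hij
    have hm : MeasurableSet {x : ι → α | x i = x j} :=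
      measurableSet_eq_fun (measurable_pi_apply i) (measurable_pi_apply j)
    have : ∫⁻ x, {x : ι → α | x i = x j}.indicator 1 x ∂Measure.pi (fun _ => μ) =
        ∫⁻ _, 0 ∂Measure.pi (fun _ : ι => μ) := by
      refine lintegral_eq_of_lmarginal_eq {i} (measurable_one.indicator hm) measurable_const ?_
      rw [lmarginal_singleton, lmarginal_singleton]
      funext x
      have : ∀ y, {x : ι → α | x i = x j}.indicator (1 : (ι → α) → ℝ≥0∞)
          (Function.update x i y) = ({x j} : Set α).indicator 1 y := by
        intro y
        by_cases h : y = x j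
        · simp [Set.indicator, h, hij.symm]
        · simp [Set.indicator, h, hij.symm]
      simp_rw [this]
      rw [lintegral_indicator_one (measurableSet_singleton _)]
      simp
    rw [lintegral_indicator_one hm, lintegral_zero] at this
    exact measure_eq_zero_iff_ae_notMem.1 this
  have : ∀ᵐ x : ι → α ∂Measure.pi (fun _ => μ), ∀ i j, i ≠ j → x i ≠ x j :=
    ae_all_iff.2 fun i => ae_all_iff.2 fun j => by
      by_cases h : i = j
      · simp [h]
      · filter_upwards [key i j h] with x hx _ using hx
  filter_upwards [this] with x hx i j hij
  by_contra h
  exact hx i j h hij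

end ProductMeasure

/-! ### The box, the potential and the Boltzmann factor -/

section Box

variable {d : ℕ} {a b : Fin d → ℝ}

theorem measurableSet_box : MeasurableSet (box a b) := by
  have : box a b = ⋂ i, {x : EuclideanSpace ℝ (Fin d) | x i ∈ Set.Ico (a i) (b i)} := by
    ext x; simp [box]
  rw [this]
  refine MeasurableSet.iInter fun i => ?_
  have h : Measurable fun x : EuclideanSpace ℝ (Fin d) => x i := by fun_prop
  exact h measurableSet_Ico

instance : StandardBorelSpace (box a b) := measurableSet_box.standardBorel

theorem nonempty_box (hab : ∀ i, a i < b i) : Nonempty (box a b) :=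
  ⟨⟨WithLp.toLp 2 a, fun i => ⟨le_rfl, hab i⟩⟩⟩

theorem isBounded_box : Bornology.IsBounded (box a b) := by
  have h : Bornology.IsBounded (Set.pi Set.univ fun i => Set.Icc (a i) (b i)) :=
    Bornology.IsBounded.pi fun i => Metric.isBounded_Icc _ _
  have h2 := (PiLp.lipschitzWith_toLp 2 (fun _ : Fin d => ℝ)).isBounded_image h
  refine h2.subset fun x hx => ⟨x.ofLp, fun i _ => Set.Ico_subset_Icc_self (hx i), rfl⟩

theorem boxVolume_univ : boxVolume a b Set.univ = volume (box a b) := by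
  rw [boxVolume, Measure.comap_apply _ Subtype.val_injective
    (fun s hs => measurableSet_box.subtype_image hs) _ MeasurableSet.univ]
  simp

instance : IsFiniteMeasure (boxVolume a b) :=
  ⟨by rw [boxVolume_univ]; exact isBounded_box.measure_lt_top⟩

instance [NeZero d] : NullSingletonClass (boxVolume a b) := by
  refine ⟨fun x => ?_⟩
  rw [boxVolume, Measure.comap_apply _ Subtype.val_injective
    (fun s hs => measurableSet_box.subtype_image hs) _ (measurableSet_singleton x)]
  simp

theorem measureReal_boxVolume_univ :
    (boxVolume a b).real Set.univ = volume.real (box a b) := by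
  rw [Measure.real, boxVolume_univ, Measure.real]

theorem measurableSet_periodicClose :
    MeasurableSet {p : EuclideanSpace ℝ (Fin d) × EuclideanSpace ℝ (Fin d) |
      PeriodicClose a b p.1 p.2} := by
  have : {p : EuclideanSpace ℝ (Fin d) × EuclideanSpace ℝ (Fin d) |
      PeriodicClose a b p.1 p.2} = ⋃ k : Fin d → ℤ, {p |
        ‖p.1 - p.2 + WithLp.toLp 2 (fun i => (k i : ℝ) * (b i - a i))‖ ≤ 1} := by
    ext p; simp [PeriodicClose]
  rw [this]
  refine MeasurableSet.iUnion fun k => (isClosed_le ?_ continuous_const).measurableSet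
  fun_prop

theorem measurable_potential : Measurable fun p : box a b × box a b => potential p.1 p.2 := by
  refine Measurable.ite ?_ measurable_const measurable_const
  have h : Measurable fun p : box a b × box a b => (p.1.1, p.2.1) := by fun_prop
  exact h measurableSet_periodicClose

theorem potential_nonneg (x y : box a b) : 0 ≤ potential x y := by
  unfold potential; split_ifs <;> norm_num

theorem boltzmann_nonneg (T h : ℝ) : 0 ≤ boltzmann T h := by
  unfold boltzmann; split_ifs <;> positivity

theorem boltzmann_le_one {T h : ℝ} (hT : 0 ≤ T) (hh : 0 ≤ h) : boltzmann T h ≤ 1 := by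
  unfold boltzmann; split_ifs
  · exact le_rfl
  · norm_num
  · rw [Real.exp_le_one_iff, neg_div]
    exact neg_nonpos.2 (div_nonneg hh hT)

theorem boltzmann_zero (T : ℝ) : boltzmann T 0 = 1 := by
  simp [boltzmann]

/-- Nonnegativity matters at `T = 0`: there the claim is that a sum vanishes only if both terms do.
-/
theorem boltzmann_add (T : ℝ) {h k : ℝ} (hh : 0 ≤ h) (hk : 0 ≤ k) :
    boltzmann T (h + k) = boltzmann T h * boltzmann T k := by
  unfold boltzmann
  by_cases hT : T = 0
  · by_cases h0 : h = 0 <;> by_cases k0 : k = 0 <;> simp [hT, h0, k0]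
    intro hhk; exact h0 (by linarith)
  · simp only [hT, if_false]
    rw [← Real.exp_add]; congr 1; ring

theorem boltzmann_sum (T : ℝ) {ι : Type*} (s : Finset ι) {h : ι → ℝ} (hh : ∀ i ∈ s, 0 ≤ h i) :
    boltzmann T (∑ i ∈ s, h i) = ∏ i ∈ s, boltzmann T (h i) := by
  induction s using Finset.induction_on with
  | empty => simp [boltzmann_zero]
  | insert i s hi ih =>
    rw [Finset.sum_insert hi, Finset.prod_insert hi, boltzmann_add, ih]
    · exact fun j hj => hh j (Finset.mem_insert_of_mem hj)
    · exact hh i (Finset.mem_insert_self i s)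
    · exact Finset.sum_nonneg fun j hj => hh j (Finset.mem_insert_of_mem hj)

theorem measurable_boltzmann (T : ℝ) : Measurable (boltzmann T) := by
  unfold boltzmann
  by_cases hT : T = 0
  · simp only [hT, if_true]
    exact Measurable.ite (measurableSet_singleton 0) measurable_const measurable_const
  · simp only [hT, if_false]
    fun_prop

end Box

/-! ### The Lebesgue–Poisson measure and normalization of Poisson processes -/

section LebesguePoisson

variable {d : ℕ} {a b : Fin d → ℝ}

theorem lintegral_lebesguePoisson {f : FiniteSubset (box a b) → ℝ≥0∞} (hf : Measurable f) :
    ∫⁻ X, f X ∂lebesguePoisson a b = ∑' n : ℕ, (n.factorial : ℝ≥0∞)⁻¹ *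
      ∫⁻ x : Fin n → box a b, f (ofTuple x) ∂Measure.pi fun _ => boxVolume a b := by
  rw [lebesguePoisson, lintegral_sum_measure]
  refine tsum_congr fun n => ?_
  rw [lintegral_smul_measure, smul_eq_mul]
  congr 1
  have e : (fun x : Fin n → box a b => (⟨Finset.univ.image x⟩ : FiniteSubset (box a b))) =
      ofTuple := by
    funext x; ext y; simp [ofTuple]
  rw [e]
  exact lintegral_map hf measurable_ofTuple

theorem tsum_inv_factorial_mul_pow {t : ℝ} (ht : 0 ≤ t) :
    ∑' n : ℕ, (n.factorial : ℝ≥0∞)⁻¹ * ENNReal.ofReal t ^ n = ENNReal.ofReal (Real.exp t) := by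
  have h := NormedSpace.expSeries_div_hasSum_exp (𝔸 := ℝ) t
  rw [← Real.exp_eq_exp_ℝ] at h
  rw [← h.tsum_eq, ENNReal.ofReal_tsum_of_nonneg (fun n => by positivity) h.summable]
  refine tsum_congr fun n => ?_
  rw [ENNReal.ofReal_div_of_pos (by positivity), ENNReal.ofReal_pow ht, ENNReal.ofReal_natCast,
    ENNReal.div_eq_inv_mul]

theorem lebesguePoisson_empty_ge :
    1 ≤ lebesguePoisson a b {X | X.pts = ∅} := by
  have hm := measurableSet_pts_eq_empty (α := box a b)
  rw [← lintegral_indicator_one hm, lintegral_lebesguePoisson (measurable_one.indicator hm)]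
  -- The term `n = 0` is a point mass at the empty set and suffices.
  refine le_trans ?_ (ENNReal.le_tsum 0)
  simp [ofTuple]

variable [NeZero d]

theorem ae_lebesguePoisson_notMem (w : box a b) :
    ∀ᵐ X ∂lebesguePoisson a b, w ∉ X.pts := by
  have hm : MeasurableSet {X : FiniteSubset (box a b) | w ∈ X.pts} := by
    have := measurable_count (α := box a b) (measurableSet_singleton w) (measurableSet_singleton 0)
    convert this.compl using 1
    ext X
    simp only [Set.mem_ofPred_eq, Set.mem_compl_iff, Set.mem_preimage, Set.mem_singleton_iff]
    rw [Set.ncard_eq_zero (Set.toFinite _)]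
    simp
  have : lebesguePoisson a b {X | w ∈ X.pts} = 0 := by
    rw [← lintegral_indicator_one hm, lintegral_lebesguePoisson (measurable_one.indicator hm)]
    refine ENNReal.tsum_eq_zero.2 fun n => ?_
    refine mul_eq_zero.2 (Or.inr ?_)
    refine (lintegral_eq_zero_iff ((measurable_one.indicator hm).comp measurable_ofTuple)).2 ?_
    have : ∀ᵐ x : Fin n → box a b ∂Measure.pi (fun _ => boxVolume a b), ∀ i, x i ≠ w :=
      ae_all_iff.2 fun i => (Measure.tendsto_eval_ae_ae (μ := fun _ : Fin n => boxVolume a b)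
        (i := i)).eventually (Measure.ae_ne _ w)
    filter_upwards [this] with x hx
    refine Set.indicator_of_notMem ?_ _
    simpa [ofTuple] using hx
  exact measure_eq_zero_iff_ae_notMem.1 this

theorem ae_lebesguePoisson_disjoint (W : Finset (box a b)) :
    ∀ᵐ X ∂lebesguePoisson a b, Disjoint X.pts W := by
  have : ∀ᵐ X ∂lebesguePoisson a b, ∀ w ∈ W, w ∉ X.pts :=
    (Finset.eventually_all W).2 fun w _ => ae_lebesguePoisson_notMem w
  filter_upwards [this] with X hX
  rw [Finset.disjoint_right]
  exact fun w hw => hX w hw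

variable [Nonempty (box a b)]

/-- For `n` points the integral factorizes into the `n`-th power of the integral of `u`, and the sum
over `n` is the exponential series. This is the inverse of the normalizing constant of the Poisson
process. -/
theorem lintegral_lebesguePoisson_prod {u : box a b → ℝ} (hu : Measurable u) (hu0 : ∀ x, 0 ≤ u x)
    (hui : Integrable u (boxVolume a b)) :
    ∫⁻ X, ENNReal.ofReal (∏ x ∈ X.pts, u x) ∂lebesguePoisson a b =
      ENNReal.ofReal (Real.exp (∫ x, u x ∂boxVolume a b)) := by
  have hm : Measurable fun X : FiniteSubset (box a b) => ENNReal.ofReal (∏ x ∈ X.pts, u x) := by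
    have := measurable_prod_pts (W := Unit) (f := fun p : Unit × box a b => u p.2)
      (hu.comp measurable_snd)
    exact (this.comp (measurable_const (a := ()).prodMk measurable_id)).ennreal_ofReal
  rw [lintegral_lebesguePoisson hm,
    ← tsum_inv_factorial_mul_pow (integral_nonneg hu0)]
  refine tsum_congr fun n => ?_
  congr 1
  rw [ofReal_integral_eq_lintegral_ofReal hui (.of_forall hu0),
    ← lintegral_pi_prod_eq_pow _ hu.ennreal_ofReal]
  refine lintegral_congr_ae ?_
  filter_upwards [ae_pi_injective (ι := Fin n) (boxVolume a b)] with x hx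
  rw [prod_ofTuple hx, ENNReal.ofReal_prod_of_nonneg fun i _ => hu0 _]

instance : IsFiniteMeasure (lebesguePoisson a b) := by
  refine ⟨?_⟩
  have := lintegral_lebesguePoisson_prod (a := a) (b := b) (u := fun _ => 1) measurable_const
    (fun _ => zero_le_one) (integrable_const _)
  simp only [Finset.prod_const_one, ENNReal.ofReal_one, lintegral_const, one_mul] at this
  rw [this]
  exact ENNReal.ofReal_lt_top

end LebesguePoisson

/-! ### Resampling one type: heat-bath invariance -/

section Config

variable {d q : ℕ} {a b : Fin d → ℝ}

/-- The extension by `0` of a function of a configuration to all tuples of finite sets. -/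
def extendZero (f : Config q a b → ℝ≥0∞) (c : Fin q → FiniteSubset (box a b)) : ℝ≥0∞ :=
  if h : Pairwise fun s t => Disjoint (c s).pts (c t).pts then f ⟨c, h⟩ else 0

theorem extendZero_val (f : Config q a b → ℝ≥0∞) (c : Config q a b) :
    extendZero f c.1 = f c := dif_pos c.2

theorem pairwise_disjoint_update_iff {c : Fin q → FiniteSubset (box a b)} {s : Fin q}
    {Y : FiniteSubset (box a b)} :
    (Pairwise fun t t' => Disjoint (Function.update c s Y t).pts (Function.update c s Y t').pts) ↔
      (∀ t t', t ≠ s → t' ≠ s → t ≠ t' → Disjoint (c t).pts (c t').pts) ∧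
      ∀ t, t ≠ s → Disjoint Y.pts (c t).pts := by
  constructor
  · intro h
    refine ⟨fun t t' ht ht' htt => ?_, fun t ht => ?_⟩
    · simpa [ht, ht'] using h htt
    · simpa [ht] using h ht.symm
  · rintro ⟨h1, h2⟩ t t' htt
    by_cases ht : t = s
    · subst ht
      simpa [htt.symm] using h2 t' htt.symm
    · by_cases ht' : t' = s
      · subst ht'
        simpa [ht] using (h2 t ht).symm
      · simpa [ht, ht'] using h1 t t' ht ht' htt

theorem disjoint_otherTypes_iff {c : Config q a b} {s : Fin q} {Y : Finset (box a b)} :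
    Disjoint Y (otherTypes s c) ↔ ∀ t, t ≠ s → Disjoint Y (c.1 t).pts := by
  simp [otherTypes, Finset.disjoint_biUnion_right]

theorem sum_otherTypes {M : Type*} [AddCommMonoid M] (c : Config q a b) (s : Fin q)
    (f : box a b → M) :
    ∑ y ∈ otherTypes s c, f y = ∑ t ∈ Finset.univ.filter (· ≠ s), ∑ y ∈ (c.1 t).pts, f y := by
  rw [otherTypes, Finset.sum_biUnion]
  exact fun t _ t' _ htt => c.2 htt

theorem otherTypes_congr {c c' : Config q a b} {s : Fin q} (h : ∀ t, t ≠ s → c.1 t = c'.1 t) :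
    otherTypes s c = otherTypes s c' := by
  refine Finset.biUnion_congr rfl fun t ht => ?_
  rw [h t (Finset.mem_filter.1 ht).2]

/-- The old particles of type `s` are discarded, so the kernel is constant in that coordinate. -/
theorem resampleType_congr {z T : ℝ} {c c' : Config q a b} {s : Fin q}
    (h : ∀ t, t ≠ s → c.1 t = c'.1 t) : resampleType z T s c = resampleType z T s c' := by
  have hu : (fun Y => Function.update c.1 s Y) = fun Y => Function.update c'.1 s Y := by
    funext Y t
    by_cases ht : t = s
    · subst ht; simp
    · simp [ht, h t ht]
  rw [resampleType, resampleType, otherTypes_congr h, hu]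

/-- The interaction energy of two finite sets of particles. -/
def interaction (X Y : Finset (box a b)) : ℝ := ∑ x ∈ X, ∑ y ∈ Y, potential x y

theorem interaction_comm (X Y : Finset (box a b)) : interaction X Y = interaction Y X := by
  rw [interaction, Finset.sum_comm]
  exact Finset.sum_congr rfl fun y _ => Finset.sum_congr rfl fun x _ => potential_comm x y

theorem interaction_nonneg (X Y : Finset (box a b)) : 0 ≤ interaction X Y :=
  Finset.sum_nonneg fun x _ => Finset.sum_nonneg fun y _ => potential_nonneg x y

theorem hamiltonian_nonneg (c : Config q a b) : 0 ≤ hamiltonian c :=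
  Finset.sum_nonneg fun _ _ => Finset.sum_nonneg fun _ _ => interaction_nonneg _ _

/-- Here `c₀` is `c` with the particles of type `s` removed; the energy they lose is their
interaction with all others. -/
theorem hamiltonian_eq_add {c c₀ : Config q a b} {s : Fin q} (h : ∀ t, t ≠ s → c.1 t = c₀.1 t)
    (h₀ : (c₀.1 s).pts = ∅) :
    hamiltonian c = hamiltonian c₀ +
      ∑ x ∈ (c.1 s).pts, ∑ y ∈ otherTypes s c₀, potential x y := by
  have e1 : ∑ x ∈ (c.1 s).pts, ∑ y ∈ otherTypes s c₀, potential x y =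
      ∑ t, if t ≠ s then interaction (c.1 s).pts (c.1 t).pts else 0 := by
    simp_rw [sum_otherTypes, interaction]
    rw [Finset.sum_comm, Finset.sum_filter]
    refine Finset.sum_congr rfl fun t _ => ?_
    by_cases ht : t = s
    · simp [ht]
    · simp [ht, h t ht]
  have e2 : ∀ c : Config q a b, hamiltonian c =
      ∑ t, ∑ t', if t < t' then interaction (c.1 t).pts (c.1 t').pts else 0 := by
    intro c
    refine Finset.sum_congr rfl fun t _ => ?_
    rw [← Finset.sum_filter]
    refine Finset.sum_congr ?_ fun _ _ => rfl
    ext t'; simp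
  -- A pair `t < t'` involves `s` as its smaller member, as its larger member, or not at all; only
  -- the last kind survives in `c₀`.
  have e3 : ∀ t t' : Fin q, (if t < t' then interaction (c.1 t).pts (c.1 t').pts else 0) =
      (if t < t' then interaction (c₀.1 t).pts (c₀.1 t').pts else 0) +
      ((if t = s then (if s < t' then interaction (c.1 s).pts (c.1 t').pts else 0) else 0) +
       (if t' = s then (if t < s then interaction (c.1 s).pts (c.1 t).pts else 0) else 0)) := by
    intro t t'
    by_cases htt : t < t'
    · by_cases ht : t = s
      · subst ht
        simp [htt, htt.ne', h₀, interaction]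
      · by_cases ht' : t' = s
        · subst ht'
          simp only [htt, if_true, ht, if_false, interaction_comm (c.1 t).pts, zero_add]
          simp [h₀, interaction]
        · simp [htt, ht, ht', h t ht, h t' ht']
    · by_cases ht : t = s
      · subst ht
        simp [htt]
      · by_cases ht' : t' = s
        · subst ht'; simp [htt]
        · simp only [ht, ht', htt, if_false, add_zero]
  rw [e1, e2 c, e2 c₀]
  rw [Finset.sum_congr rfl fun t _ => Finset.sum_congr rfl fun t' _ => e3 t t']
  simp_rw [Finset.sum_add_distrib]
  congr 1
  simp only [Finset.sum_ite_eq', Finset.mem_univ, if_true]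
  rw [Finset.sum_comm]
  simp only [Finset.sum_ite_eq', Finset.mem_univ, if_true]
  rw [← Finset.sum_add_distrib]
  refine Finset.sum_congr rfl fun t _ => ?_
  rcases lt_trichotomy s t with hst | hst | hst
  · simp [hst, hst.ne', hst.not_gt]
  · simp [hst]
  · simp [hst, hst.ne, hst.not_gt]

/-- The unnormalized Gibbs density with respect to the product of Lebesgue–Poisson measures. -/
def gibbsWeight (z T : ℝ) (c : Config q a b) : ℝ :=
  boltzmann T (hamiltonian c) * ∏ s, z ^ (c.1 s).pts.card

theorem gibbsWeight_nonneg {z T : ℝ} (hz : 0 < z) (c : Config q a b) :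
    0 ≤ gibbsWeight z T c :=
  mul_nonneg (boltzmann_nonneg _ _) (Finset.prod_nonneg fun _ _ => by positivity)

/-- The intensity of the particles of type `s`, given the other ones. -/
def intensity (z T : ℝ) (s : Fin q) (c : Config q a b) (x : box a b) : ℝ :=
  z * boltzmann T (∑ y ∈ otherTypes s c, potential x y)

/-- The Boltzmann factor of the energy gained splits over the added points, and each takes one
factor `z`. This identifies the conditional density of type `s` with a Poisson density. -/
theorem gibbsWeight_eq_mul {z T : ℝ} {c c₀ : Config q a b} {s : Fin q}
    (h : ∀ t, t ≠ s → c.1 t = c₀.1 t) (h₀ : (c₀.1 s).pts = ∅) :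
    gibbsWeight z T c = gibbsWeight z T c₀ * ∏ x ∈ (c.1 s).pts, intensity z T s c₀ x := by
  have hp : ∏ t, z ^ (c.1 t).pts.card = (∏ t, z ^ (c₀.1 t).pts.card) * z ^ (c.1 s).pts.card := by
    rw [← Finset.prod_erase_mul _ _ (Finset.mem_univ s),
      ← Finset.prod_erase_mul _ (fun t => z ^ (c₀.1 t).pts.card) (Finset.mem_univ s)]
    simp only [h₀, Finset.card_empty, pow_zero, mul_one]
    congr 1
    exact Finset.prod_congr rfl fun t ht => by rw [h t (Finset.ne_of_mem_erase ht)]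
  simp only [gibbsWeight, intensity]
  rw [hamiltonian_eq_add h h₀, boltzmann_add, boltzmann_sum, hp, Finset.prod_mul_distrib,
    Finset.prod_const]
  · ring
  · exact fun x _ => Finset.sum_nonneg fun y _ => potential_nonneg x y
  · exact hamiltonian_nonneg c₀
  · exact Finset.sum_nonneg fun x _ => Finset.sum_nonneg fun y _ => potential_nonneg x y

theorem intensity_nonneg {z T : ℝ} (hz : 0 < z) (s : Fin q) (c : Config q a b) (x : box a b) :
    0 ≤ intensity z T s c x :=
  mul_nonneg hz.le (boltzmann_nonneg _ _)

theorem intensity_le {z T : ℝ} (hz : 0 < z) (hT : 0 ≤ T) (s : Fin q) (c : Config q a b)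
    (x : box a b) : intensity z T s c x ≤ z :=
  mul_le_of_le_one_right hz.le
    (boltzmann_le_one hT (Finset.sum_nonneg fun y _ => potential_nonneg x y))

theorem measurable_config_apply (t : Fin q) : Measurable fun c : Config q a b => c.1 t :=
  (measurable_pi_apply t).comp measurable_subtype_coe

variable [Nonempty (box a b)]

theorem measurableSet_config : MeasurableSet {c : Fin q → FiniteSubset (box a b) |
    Pairwise fun s t => Disjoint (c s).pts (c t).pts} := by
  have : {c : Fin q → FiniteSubset (box a b) | Pairwise fun s t => Disjoint (c s).pts (c t).pts} =
      ⋂ s, ⋂ t, ⋂ _ : s ≠ t, {c | Disjoint (c s).pts (c t).pts} := by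
    ext c; simp [Pairwise]
  rw [this]
  refine MeasurableSet.iInter fun s => MeasurableSet.iInter fun t =>
    MeasurableSet.iInter fun _ => ?_
  have h : Measurable fun c : Fin q → FiniteSubset (box a b) => (c s, c t) := by fun_prop
  exact h measurableSet_disjoint

theorem measurable_extendZero {f : Config q a b → ℝ≥0∞} (hf : Measurable f) :
    Measurable (extendZero f) :=
  Measurable.dite hf measurable_const measurableSet_config

theorem lintegral_comap_val (μ : Measure (Fin q → FiniteSubset (box a b)))
    (f : Config q a b → ℝ≥0∞) :
    ∫⁻ c, f c ∂(μ.comap (Subtype.val : Config q a b → _)) = ∫⁻ c, extendZero f c ∂μ := by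
  have h := lintegral_subtype_comap (μ := μ) (measurableSet_config (q := q) (a := a) (b := b))
    (extendZero f)
  rw [← lintegral_indicator measurableSet_config] at h
  simp_rw [← extendZero_val f]
  refine h.trans (lintegral_congr fun c => ?_)
  by_cases hc : c ∈ {c : Fin q → FiniteSubset (box a b) |
    Pairwise fun s t => Disjoint (c s).pts (c t).pts}
  · rw [Set.indicator_of_mem hc]
  · rw [Set.indicator_of_notMem hc]; rw [extendZero, dif_neg (by exact hc)]

theorem measurable_sum_otherTypes (s : Fin q) :
    Measurable fun p : Config q a b × box a b => ∑ y ∈ otherTypes s p.1, potential p.2 y := by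
  simp_rw [sum_otherTypes]
  refine Finset.measurable_sum _ fun t _ => ?_
  have h := measurable_sum_pts (measurable_potential (a := a) (b := b))
  have h2 : Measurable fun p : Config q a b × box a b => (p.2, p.1.1 t) :=
    measurable_snd.prodMk ((measurable_config_apply t).comp measurable_fst)
  have h3 := h.comp h2
  exact h3

theorem measurable_intensity (z T : ℝ) (s : Fin q) :
    Measurable fun p : Config q a b × box a b => intensity z T s p.1 p.2 :=
  ((measurable_boltzmann T).comp (measurable_sum_otherTypes s)).const_mul z

theorem measurable_intensity_right (z T : ℝ) (s : Fin q) (c : Config q a b) :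
    Measurable (intensity z T s c) := by
  have h : Measurable fun x : box a b => (c, x) := measurable_prodMk_left
  have h' := (measurable_intensity z T s).comp h
  exact h'

theorem integrable_intensity {z T : ℝ} (hz : 0 < z) (hT : 0 ≤ T) (s : Fin q) (c : Config q a b) :
    Integrable (intensity z T s c) (boxVolume a b) := by
  refine Integrable.of_bound (measurable_intensity_right z T s c).aestronglyMeasurable z ?_
  refine .of_forall fun x => ?_
  rw [Real.norm_of_nonneg (intensity_nonneg hz s c x)]
  exact intensity_le hz hT s c x

theorem measurable_prod_intensity (z T : ℝ) (s : Fin q) :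
    Measurable fun p : Config q a b × FiniteSubset (box a b) =>
      ∏ x ∈ p.2.pts, intensity z T s p.1 x :=
  measurable_prod_pts (measurable_intensity z T s)

theorem measurable_prod_intensity_right (z T : ℝ) (s : Fin q) (c : Config q a b) :
    Measurable fun Y : FiniteSubset (box a b) => ∏ x ∈ Y.pts, intensity z T s c x := by
  have h : Measurable fun Y : FiniteSubset (box a b) => (c, Y) := measurable_prodMk_left
  have h' := (measurable_prod_intensity z T s).comp h
  exact h'

theorem lintegral_resampleType (z T : ℝ) (s : Fin q) (c : Config q a b)
    {f : Config q a b → ℝ≥0∞} (hf : Measurable f) :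
    ∫⁻ c', f c' ∂resampleType z T s c =
      ENNReal.ofReal (Real.exp (-∫ x, intensity z T s c x ∂boxVolume a b)) *
      ∫⁻ Y, ENNReal.ofReal (∏ x ∈ Y.pts, intensity z T s c x) *
        extendZero f (Function.update c.1 s Y) ∂lebesguePoisson a b := by
  have hu : Measurable fun Y => Function.update c.1 s Y := measurable_update c.1
  rw [resampleType, lintegral_comap_val, lintegral_map (measurable_extendZero hf) hu,
    poissonProcess, lintegral_smul_measure, smul_eq_mul,
    lintegral_withDensity_eq_lintegral_mul]
  · rfl
  · exact (measurable_prod_intensity_right z T s c).ennreal_ofReal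
  · exact (measurable_extendZero hf).comp hu

theorem measurable_resampleType (z T : ℝ) [IsFiniteMeasure (lebesguePoisson a b)] (s : Fin q) :
    Measurable (resampleType z T s : Config q a b → Measure (Config q a b)) := by
  refine Measure.measurable_of_measurable_coe _ fun A hA => ?_
  have hf : Measurable (A.indicator (1 : Config q a b → ℝ≥0∞)) := measurable_one.indicator hA
  simp_rw [← lintegral_indicator_one hA, lintegral_resampleType z T s _ hf]
  refine Measurable.mul ?_ ?_
  · refine (Real.measurable_exp.comp (Measurable.neg ?_)).ennreal_ofReal
    exact ((measurable_intensity z T s).stronglyMeasurable.integral_prod_right).measurable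
  · refine Measurable.lintegral_prod_right' (f := fun p : Config q a b × FiniteSubset (box a b) =>
      ENNReal.ofReal (∏ x ∈ p.2.pts, intensity z T s p.1 x) *
        extendZero (A.indicator 1) (Function.update p.1.1 s p.2)) ?_
    refine (measurable_prod_intensity z T s).ennreal_ofReal.mul ((measurable_extendZero hf).comp ?_)
    exact measurable_update'.comp
      ((measurable_subtype_coe.comp measurable_fst).prodMk measurable_snd)

theorem measurable_hamiltonian : Measurable (hamiltonian : Config q a b → ℝ) := by
  unfold hamiltonian
  refine Finset.measurable_sum _ fun s _ => Finset.measurable_sum _ fun t _ => ?_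
  have h1 := measurable_sum_pts (measurable_potential (a := a) (b := b))
  have h2 : Measurable fun p : FiniteSubset (box a b) × box a b =>
      ∑ y ∈ p.1.pts, potential p.2 y := by
    have h := h1.comp measurable_swap
    exact h
  have h3 := measurable_sum_pts h2
  have h4 := h3.comp ((measurable_config_apply (a := a) (b := b) t).prodMk
    (measurable_config_apply s))
  exact h4

theorem measurable_gibbsWeight (z T : ℝ) :
    Measurable (gibbsWeight z T : Config q a b → ℝ) := by
  refine ((measurable_boltzmann T).comp measurable_hamiltonian).mul
    (Finset.measurable_prod _ fun s _ => ?_)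
  exact (measurable_of_countable (fun n : ℕ => z ^ n)).comp (measurable_card.comp
    ((measurable_pi_apply s).comp measurable_subtype_coe))

theorem lintegral_gibbsUnnormalized (z T : ℝ) {f : Config q a b → ℝ≥0∞} (hf : Measurable f) :
    ∫⁻ c, f c ∂gibbsUnnormalized q a b z T =
      ∫⁻ c, extendZero (fun c => ENNReal.ofReal (gibbsWeight z T c) * f c) c
        ∂Measure.pi fun _ => lebesguePoisson a b := by
  rw [gibbsUnnormalized, lintegral_withDensity_eq_lintegral_mul _ _ hf, lintegral_comap_val]
  · rfl
  · exact (measurable_gibbsWeight z T).ennreal_ofReal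

/-- A Poisson sample is empty with probability the exponential of minus its total intensity, and the
intensity is bounded by `z`. -/
theorem le_resampleType {z T : ℝ} (hz : 0 < z) (hT : 0 ≤ T) {s : Fin q}
    {c : Config q a b} {A : Set (Config q a b)} (hA : MeasurableSet A)
    (h : ∀ c' : Config q a b, (c'.1 s).pts = ∅ → (∀ t, t ≠ s → c'.1 t = c.1 t) → c' ∈ A) :
    ENNReal.ofReal (Real.exp (-(z * volume.real (box a b)))) ≤ resampleType z T s c A := by
  rw [← lintegral_indicator_one hA, lintegral_resampleType z T s c (measurable_one.indicator hA)]
  have h1 : ∫ x, intensity z T s c x ∂boxVolume a b ≤ z * volume.real (box a b) := by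
    calc ∫ x, intensity z T s c x ∂boxVolume a b ≤ ∫ _, z ∂boxVolume a b :=
          integral_mono (integrable_intensity hz hT s c) (integrable_const z)
            (intensity_le hz hT s c)
      _ = z * volume.real (box a b) := by
          rw [integral_const, measureReal_boxVolume_univ, smul_eq_mul, mul_comm]
  have h2 : 1 ≤ ∫⁻ Y, ENNReal.ofReal (∏ x ∈ Y.pts, intensity z T s c x) *
        extendZero (A.indicator 1) (Function.update c.1 s Y) ∂lebesguePoisson a b := by
    refine (lebesguePoisson_empty_ge (a := a) (b := b)).trans ?_
    rw [← lintegral_indicator_one measurableSet_pts_eq_empty]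
    refine lintegral_mono fun Y => ?_
    by_cases hY : Y.pts = ∅
    swap
    · rw [Set.indicator_of_notMem (by exact hY)]; exact zero_le
    rw [Set.indicator_of_mem (by exact hY)]
    have hp : Pairwise fun t t' => Disjoint (Function.update c.1 s Y t).pts
        (Function.update c.1 s Y t').pts :=
      pairwise_disjoint_update_iff.2 ⟨fun t t' _ _ htt => c.2 htt, fun t _ => by simp [hY]⟩
    rw [extendZero, dif_pos hp, Set.indicator_of_mem]
    · simp [hY]
    · refine h _ ?_ fun t ht => ?_
      · simp [hY]
      · simp [ht]
  calc _ ≤ ENNReal.ofReal (Real.exp (-∫ x, intensity z T s c x ∂boxVolume a b)) * 1 := by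
        rw [mul_one]
        exact ENNReal.ofReal_le_ofReal (Real.exp_le_exp.2 (neg_le_neg h1))
    _ ≤ _ := by gcongr

variable [NeZero d]

theorem lintegral_prod_intensity {z T : ℝ} (hz : 0 < z) (hT : 0 ≤ T) (s : Fin q)
    (c : Config q a b) :
    ∫⁻ Y, ENNReal.ofReal (∏ x ∈ Y.pts, intensity z T s c x) ∂lebesguePoisson a b =
      ENNReal.ofReal (Real.exp (∫ x, intensity z T s c x ∂boxVolume a b)) :=
  lintegral_lebesguePoisson_prod (measurable_intensity_right z T s c)
    (intensity_nonneg hz s c) (integrable_intensity hz hT s c)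

/-- Restricting to disjoint tuples costs no mass, since new points almost surely avoid the finitely
many old ones. -/
theorem isProbabilityMeasure_resampleType {z T : ℝ} (hz : 0 < z) (hT : 0 ≤ T) (s : Fin q)
    (c : Config q a b) : IsProbabilityMeasure (resampleType z T s c) := by
  refine ⟨?_⟩
  rw [← lintegral_one, lintegral_resampleType z T s c measurable_const]
  have : ∫⁻ Y, ENNReal.ofReal (∏ x ∈ Y.pts, intensity z T s c x) *
      extendZero (fun _ => 1) (Function.update c.1 s Y) ∂lebesguePoisson a b =
      ∫⁻ Y, ENNReal.ofReal (∏ x ∈ Y.pts, intensity z T s c x) ∂lebesguePoisson a b := by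
    refine lintegral_congr_ae ?_
    filter_upwards [ae_lebesguePoisson_disjoint (otherTypes s c)] with Y hY
    rw [extendZero, dif_pos, mul_one]
    rw [pairwise_disjoint_update_iff]
    exact ⟨fun t t' _ _ htt => c.2 htt, disjoint_otherTypes_iff.1 hY⟩
  rw [this, lintegral_prod_intensity hz hT, ← ENNReal.ofReal_mul (Real.exp_pos _).le,
    ← Real.exp_add]
  simp

theorem gibbsUnnormalized_bind_resampleType {z T : ℝ} (hz : 0 < z) (hT : 0 ≤ T) (s : Fin q) :
    (gibbsUnnormalized q a b z T).bind (resampleType z T s) = gibbsUnnormalized q a b z T := by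
  have hmeas := measurable_resampleType (a := a) (b := b) z T s
  ext A hA
  have hA1 : Measurable (A.indicator (1 : Config q a b → ℝ≥0∞)) := measurable_one.indicator hA
  have hR : Measurable fun c => resampleType z T s c A := Measure.measurable_coe hA |>.comp hmeas
  have hw := (measurable_gibbsWeight (q := q) (a := a) (b := b) z T).ennreal_ofReal
  rw [Measure.bind_apply hA hmeas.aemeasurable, lintegral_gibbsUnnormalized z T hR,
    ← lintegral_indicator_one hA, lintegral_gibbsUnnormalized z T hA1]
  -- It suffices to compare the integrals over the coordinate `s`, the other types being frozen.
  refine lintegral_eq_of_lmarginal_eq {s} (measurable_extendZero (hw.mul hR))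
    (measurable_extendZero (hw.mul hA1)) ?_
  rw [lmarginal_singleton, lmarginal_singleton]
  funext x
  by_cases hx : ∀ t t', t ≠ s → t' ≠ s → t ≠ t' → Disjoint (x t).pts (x t').pts
  swap
  -- If the frozen types already overlap, both sides vanish.
  · have : ∀ (f : Config q a b → ℝ≥0∞) Y, extendZero f (Function.update x s Y) = 0 :=
      fun f Y => dif_neg fun h => hx (pairwise_disjoint_update_iff.1 h).1
    simp [this]
  obtain ⟨c₀, hc₀⟩ : ∃ c₀ : Config q a b, c₀.1 = Function.update x s ⟨∅⟩ :=
    ⟨⟨_, pairwise_disjoint_update_iff.2 ⟨hx, fun t _ => by simp⟩⟩, rfl⟩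
  have h₀ : (c₀.1 s).pts = ∅ := by simp [hc₀]
  have hup : ∀ Y, Function.update x s Y = Function.update c₀.1 s Y := by
    intro Y; simp [hc₀]
  simp_rw [hup]
  have hext : ∀ (f : Config q a b → ℝ≥0∞) Y,
      extendZero (fun c => ENNReal.ofReal (gibbsWeight z T c) * f c) (Function.update c₀.1 s Y) =
      ENNReal.ofReal (gibbsWeight z T c₀) *
        (ENNReal.ofReal (∏ x ∈ Y.pts, intensity z T s c₀ x) *
          extendZero f (Function.update c₀.1 s Y)) := by
    intro f Y
    unfold extendZero
    split_ifs with h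
    on_goal 1 => beta_reduce
    · rw [gibbsWeight_eq_mul (c := ⟨Function.update c₀.1 s Y, h⟩) (s := s) (c₀ := c₀)
          (fun t ht => by simp [ht]) h₀,
        ENNReal.ofReal_mul (gibbsWeight_nonneg hz c₀), mul_assoc]
      simp
    · simp
  simp_rw [hext]
  have hm1 : ∀ f : Config q a b → ℝ≥0∞, Measurable f → Measurable fun Y : FiniteSubset (box a b) =>
      ENNReal.ofReal (∏ x ∈ Y.pts, intensity z T s c₀ x) *
          extendZero f (Function.update c₀.1 s Y) := fun f hf =>
    (measurable_prod_intensity_right z T s c₀).ennreal_ofReal.mul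
      ((measurable_extendZero hf).comp (measurable_update c₀.1))
  rw [lintegral_const_mul _ (hm1 _ hR), lintegral_const_mul _ (hm1 _ hA1)]
  congr 1
  -- The resampled law does not depend on `Y`, so it leaves the integral; the remaining mass cancels
  -- the Poisson normalization.
  have : ∫⁻ Y, ENNReal.ofReal (∏ x ∈ Y.pts, intensity z T s c₀ x) *
      extendZero (fun c => resampleType z T s c A) (Function.update c₀.1 s Y)
        ∂lebesguePoisson a b =
      ∫⁻ Y, ENNReal.ofReal (∏ x ∈ Y.pts, intensity z T s c₀ x) * resampleType z T s c₀ A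
        ∂lebesguePoisson a b := by
    refine lintegral_congr_ae ?_
    filter_upwards [ae_lebesguePoisson_disjoint (otherTypes s c₀)] with Y hY
    congr 1
    rw [extendZero, dif_pos]
    · rw [resampleType_congr (c' := c₀)]
      intro t ht; simp [ht]
    · exact pairwise_disjoint_update_iff.2
        ⟨fun t t' _ _ htt => c₀.2 htt, disjoint_otherTypes_iff.1 hY⟩
  rw [this, lintegral_mul_const _ (measurable_prod_intensity_right z T s c₀).ennreal_ofReal,
    lintegral_prod_intensity hz hT, ← lintegral_indicator_one hA,
    lintegral_resampleType z T s c₀ hA1, ← mul_assoc, ← ENNReal.ofReal_mul (Real.exp_pos _).le,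
    ← Real.exp_add]
  simp

end Config

/-! ### Colorings and multinomial coefficients -/

section Counting

/-- The numbers of points of the colours, in a coloring of finitely many points. -/
def colorCount {ι : Type*} [Fintype ι] {q : ℕ} (τ : ι → Fin q) (s : Fin q) : ℕ :=
  Fintype.card {i // τ i = s}

/-- Expand the `n`-th power of the sum of the variables `X_s` both by the multinomial theorem and as
a sum over words, and compare the coefficients of the monomial with exponent `m`. -/
theorem card_filter_colorCount {q n : ℕ} {m : Fin q → ℕ} (hm : m ∈ Finset.univ.piAntidiag n) :
    (Finset.univ.filter fun τ : Fin n → Fin q => colorCount τ = m).card =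
      Nat.multinomial Finset.univ m := by
  have h1 := Finset.sum_pow_eq_sum_piAntidiag (R := MvPolynomial (Fin q) ℕ) Finset.univ
    MvPolynomial.X n
  have h2 := Fintype.sum_pow (R := MvPolynomial (Fin q) ℕ) MvPolynomial.X n
  rw [h1] at h2
  have hX : ∀ k : Fin q → ℕ, ∏ i, (MvPolynomial.X i : MvPolynomial (Fin q) ℕ) ^ k i =
      MvPolynomial.monomial (Finsupp.equivFunOnFinite.symm k) 1 := by
    intro k
    rw [MvPolynomial.monomial_eq, Finsupp.prod_fintype]
    · simp
    · simp
  have hτ : ∀ τ : Fin n → Fin q, ∏ i, (MvPolynomial.X (τ i) : MvPolynomial (Fin q) ℕ) =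
      MvPolynomial.monomial (Finsupp.equivFunOnFinite.symm (colorCount τ)) 1 := by
    intro τ
    rw [← hX, ← Finset.prod_fiberwise Finset.univ τ]
    refine Finset.prod_congr rfl fun s _ => ?_
    rw [Finset.prod_congr rfl (g := fun _ => (MvPolynomial.X s : MvPolynomial (Fin q) ℕ)),
      Finset.prod_const, colorCount, Fintype.card_subtype]
    intro i hi
    rw [(Finset.mem_filter.1 hi).2]
  simp_rw [hτ, hX] at h2
  have h3 := congrArg (MvPolynomial.coeff (Finsupp.equivFunOnFinite.symm m)) h2
  simp only [MvPolynomial.coeff_sum, ← nsmul_eq_mul, MvPolynomial.coeff_smul,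
    MvPolynomial.coeff_monomial, EmbeddingLike.apply_eq_iff_eq] at h3
  rw [Finset.card_filter, ← h3]
  simp [Finset.sum_ite_eq', hm]

theorem tsum_pi_prod {q : ℕ} (w : Fin q → ℕ → ℝ≥0∞) :
    ∑' m : Fin q → ℕ, ∏ s, w s (m s) = ∏ s, ∑' k, w s k := by
  induction q with
  | zero => simp
  | succ q ih =>
    rw [← (Fin.consEquiv fun _ => ℕ).tsum_eq, ENNReal.tsum_prod', Fin.prod_univ_succ,
      ← ih fun s => w s.succ]
    simp only [Fin.consEquiv_apply, Fin.prod_univ_succ, Fin.cons_zero, Fin.cons_succ]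
    simp_rw [ENNReal.tsum_mul_left, ENNReal.tsum_mul_right]

/-- Group the colorings by their colour counts `m`: dividing the multinomial coefficient by `n!`
leaves the product of the `1 / m_s!`, and summing over all `m` factorizes. -/
theorem tsum_sum_prod_colorCount {q : ℕ} (v : Fin q → ℕ → ℝ≥0∞) :
    ∑' n : ℕ, (n.factorial : ℝ≥0∞)⁻¹ * ∑ τ : Fin n → Fin q, ∏ s, v s (colorCount τ s) =
      ∏ s, ∑' k : ℕ, (k.factorial : ℝ≥0∞)⁻¹ * v s k := by
  rw [← tsum_pi_prod fun s k => (k.factorial : ℝ≥0∞)⁻¹ * v s k]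
  have hsum : ∀ {n : ℕ} (τ : Fin n → Fin q), colorCount τ ∈ Finset.univ.piAntidiag n := by
    intro n τ
    rw [Finset.mem_piAntidiag]
    refine ⟨?_, by simp⟩
    have := Fintype.card_congr (Equiv.sigmaFiberEquiv τ)
    rw [Fintype.card_sigma, Fintype.card_fin] at this
    exact this
  have key : ∀ n : ℕ, (n.factorial : ℝ≥0∞)⁻¹ * ∑ τ : Fin n → Fin q, ∏ s, v s (colorCount τ s) =
      ∑ m ∈ Finset.univ.piAntidiag n, ∏ s, ((m s).factorial : ℝ≥0∞)⁻¹ * v s (m s) := by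
    intro n
    rw [← Finset.sum_fiberwise_of_maps_to (t := Finset.univ.piAntidiag n) (g := colorCount)
      (fun τ _ => hsum τ), Finset.mul_sum]
    refine Finset.sum_congr rfl fun m hm => ?_
    rw [Finset.sum_congr rfl (g := fun _ => ∏ s, v s (m s)), Finset.sum_const,
      card_filter_colorCount hm, Finset.prod_mul_distrib, nsmul_eq_mul, ← mul_assoc]
    · congr 1
      have h := Nat.multinomial_spec Finset.univ m
      rw [(Finset.mem_piAntidiag.1 hm).1] at h
      rw [← h]
      push_cast
      have h0 : (∏ s, ((m s).factorial : ℝ≥0∞)) ≠ 0 := by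
        simp [Finset.prod_ne_zero_iff, Nat.factorial_ne_zero]
      have h0' : (∏ s, ((m s).factorial : ℝ≥0∞)) ≠ ∞ := by
        rw [← Nat.cast_prod]; exact ENNReal.natCast_ne_top _
      have h1 : (Nat.multinomial Finset.univ m : ℝ≥0∞) ≠ 0 := by
        exact_mod_cast (Nat.multinomial_pos Finset.univ m).ne'
      rw [ENNReal.mul_inv (Or.inl h0) (Or.inl h0'), mul_assoc,
        ENNReal.inv_mul_cancel h1 (ENNReal.natCast_ne_top _), mul_one]
      exact ENNReal.prod_inv_distrib fun s _ t _ _ => Or.inr (ENNReal.natCast_ne_top _)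
    · intro τ hτ
      rw [(Finset.mem_filter.1 hτ).2]
  simp_rw [key]
  have e := (Equiv.sigmaFiberEquiv fun m : Fin q → ℕ => ∑ s, m s).tsum_eq
    (fun m => ∏ s, ((m s).factorial : ℝ≥0∞)⁻¹ * v s (m s))
  rw [← e, ENNReal.tsum_sigma']
  refine tsum_congr fun n => ?_
  have : ∀ m, m ∈ Finset.univ.piAntidiag n ↔ ∑ s : Fin q, m s = n := by
    intro m; simp [Finset.mem_piAntidiag]
  rw [← Finset.tsum_subtype]
  refine (Equiv.subtypeEquivRight fun m => ?_).tsum_eq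
    (fun m : {m : Fin q → ℕ // ∑ s, m s = n} => ∏ s, ((m.1 s).factorial : ℝ≥0∞)⁻¹ * v s (m.1 s))
  exact this m

end Counting

/-! ### Splitting a tuple of points by colour -/

section ColoredTuple

variable {α : Type*}

/-- The tuple of the sets of points of the different colours. -/
def colored {ι : Type*} [Fintype ι] {q : ℕ} (x : ι → α) (τ : ι → Fin q) :
    Fin q → FiniteSubset α :=
  fun s => ofTuple fun i : {i // τ i = s} => x i

theorem mem_colored {ι : Type*} [Fintype ι] {q : ℕ} {x : ι → α} {τ : ι → Fin q} {s : Fin q}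
    {y : α} : y ∈ (colored x τ s).pts ↔ ∃ i, τ i = s ∧ x i = y := by
  simp [colored, ofTuple]

theorem pairwise_disjoint_colored {ι : Type*} [Fintype ι] {q : ℕ} {x : ι → α}
    (hx : Function.Injective x) (τ : ι → Fin q) :
    Pairwise fun s t => Disjoint (colored x τ s).pts (colored x τ t).pts := by
  intro s t hst
  rw [Finset.disjoint_left]
  intro y hs ht
  obtain ⟨i, hi, rfl⟩ := mem_colored.1 hs
  obtain ⟨j, hj, hij⟩ := mem_colored.1 ht
  rw [hx hij] at hj
  exact hst (hi.symm.trans hj)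

variable [MeasurableSpace α]

/-- The set of values ignores the labels; this replaces a fibre of a coloring by `Fin` of its size.
-/
theorem pi_ofTuple_equiv {ι ι' : Type*} [Fintype ι] [Fintype ι'] (e : ι ≃ ι') (μ : Measure α)
    [SigmaFinite μ] (A : Set (FiniteSubset α)) :
    Measure.pi (fun _ : ι => μ) {x | ofTuple x ∈ A} =
      Measure.pi (fun _ : ι' => μ) {x | ofTuple x ∈ A} := by
  have h := measurePreserving_piCongrLeft (fun _ : ι' => μ) e
  rw [← h.measure_preimage_equiv]
  congr 1
  ext x
  have : ofTuple (MeasurableEquiv.piCongrLeft (fun _ : ι' => α) e x) = ofTuple x := by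
    ext y
    simp only [ofTuple, Finset.mem_image, Finset.mem_univ, true_and]
    rw [← e.exists_congr_right]
    refine exists_congr fun i => ?_
    rw [MeasurableEquiv.coe_piCongrLeft, Equiv.piCongrLeft_apply_apply]
  simp [this]

/-- The product over all indices is the iterated product over the fibres of `τ`, as seen on
rectangles. -/
theorem measurePreserving_fiberwise {ι : Type*} [Fintype ι] {q : ℕ} (τ : ι → Fin q)
    (μ : Measure α) [SigmaFinite μ] :
    MeasurePreserving (fun (y : ∀ s, {i // τ i = s} → α) i => y (τ i) ⟨i, rfl⟩)
      (Measure.pi fun _ => Measure.pi fun _ => μ) (Measure.pi fun _ => μ) := by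
  have hm : Measurable (fun (y : ∀ s, {i // τ i = s} → α) i => y (τ i) ⟨i, rfl⟩) :=
    measurable_pi_lambda _ fun i => (measurable_pi_apply _).comp (measurable_pi_apply _)
  refine ⟨hm, (Measure.pi_eq fun B hB => ?_).symm⟩
  rw [Measure.map_apply hm (MeasurableSet.univ_pi hB)]
  have : (fun (y : ∀ s, {i // τ i = s} → α) i => y (τ i) ⟨i, rfl⟩) ⁻¹' (Set.pi Set.univ B) =
      Set.pi Set.univ fun s => Set.pi Set.univ fun i : {i // τ i = s} => B i := by
    ext y
    simp only [Set.mem_preimage, Set.mem_pi, Set.mem_univ, true_imp_iff]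
    exact ⟨fun h s ⟨i, hi⟩ => by subst hi; exact h i, fun h i => h _ ⟨i, rfl⟩⟩
  rw [this, Measure.pi_pi]
  simp_rw [Measure.pi_pi]
  exact Fintype.prod_fiberwise τ fun i => μ (B i)

variable [StandardBorelSpace α]

theorem measurable_colored {ι : Type*} [Fintype ι] {q : ℕ} (τ : ι → Fin q) :
    Measurable fun x : ι → α => colored x τ := by
  refine measurable_pi_lambda _ fun s => measurable_ofTuple.comp ?_
  exact measurable_pi_lambda _ fun i => measurable_pi_apply _

theorem pi_colored {ι : Type*} [Fintype ι] {q : ℕ} (τ : ι → Fin q) (μ : Measure α)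
    [SigmaFinite μ] {A : Fin q → Set (FiniteSubset α)} (hA : ∀ s, MeasurableSet (A s)) :
    Measure.pi (fun _ : ι => μ) {x | ∀ s, colored x τ s ∈ A s} =
      ∏ s, Measure.pi (fun _ : Fin (colorCount τ s) => μ) {x | ofTuple x ∈ A s} := by
  have hm : MeasurableSet {x : ι → α | ∀ s, colored x τ s ∈ A s} := by
    rw [Set.ofPred_forall]
    exact MeasurableSet.iInter fun s =>
      ((measurable_pi_apply s).comp (measurable_colored τ)) (hA s)
  rw [← (measurePreserving_fiberwise τ μ).measure_preimage hm.nullMeasurableSet]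
  have : (fun (y : ∀ s, {i // τ i = s} → α) i => y (τ i) ⟨i, rfl⟩) ⁻¹'
      {x : ι → α | ∀ s, colored x τ s ∈ A s} =
      Set.pi Set.univ fun s => {x | ofTuple x ∈ A s} := by
    ext y
    simp only [Set.mem_preimage, Set.mem_pi, Set.mem_univ, true_imp_iff, Set.mem_ofPred_eq]
    refine forall_congr' fun s => ?_
    have : colored (fun i => y (τ i) ⟨i, rfl⟩) τ s = ofTuple (y s) := by
      rw [colored]
      congr 1
      funext ⟨i, hi⟩
      subst hi
      rfl
    rw [this]
  rw [this, Measure.pi_pi]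
  exact Finset.prod_congr rfl fun s _ => pi_ofTuple_equiv (Fintype.equivFin _) μ (A s)

end ColoredTuple

/-! ### The Gibbs measure as colored unlabelled points -/

section Master

variable {d q : ℕ} {a b : Fin d → ℝ}

/-- Both measures need only be compared on rectangles. There, each coloring gives a product of
single-colour volumes, and the sum over colorings factorizes by `tsum_sum_prod_colorCount`. -/
theorem pi_lebesguePoisson [IsFiniteMeasure (lebesguePoisson a b)] :
    Measure.pi (fun _ : Fin q => lebesguePoisson a b) =
      Measure.sum fun n : ℕ => (n.factorial : ℝ≥0∞)⁻¹ • ∑ τ : Fin n → Fin q,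
        (Measure.pi fun _ : Fin n => boxVolume a b).map fun x => colored x τ := by
  refine Measure.pi_eq fun A hA => ?_
  have hL : ∀ s, lebesguePoisson a b (A s) = ∑' k : ℕ, (k.factorial : ℝ≥0∞)⁻¹ *
      Measure.pi (fun _ : Fin k => boxVolume a b) {x | ofTuple x ∈ A s} := by
    intro s
    rw [← lintegral_indicator_one (hA s),
      lintegral_lebesguePoisson (measurable_one.indicator (hA s))]
    refine tsum_congr fun k => ?_
    have hm : MeasurableSet {x : Fin k → box a b | ofTuple x ∈ A s} := measurable_ofTuple (hA s)
    rw [← lintegral_indicator_one hm]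
    rfl
  simp_rw [hL]
  rw [Measure.sum_apply _ (MeasurableSet.univ_pi hA), ← tsum_sum_prod_colorCount]
  refine tsum_congr fun n => ?_
  rw [Measure.smul_apply, smul_eq_mul, Measure.finsetSum_apply]
  congr 1
  refine Finset.sum_congr rfl fun τ _ => ?_
  rw [Measure.map_apply (measurable_colored τ) (MeasurableSet.univ_pi hA), ← pi_colored τ _ hA]
  congr 1
  ext x; simp

/-- The configuration of the colored points `x i`, of colour `τ i` (and the empty configuration
if these points are not distinct). -/
def coloredConfig {ι : Type*} [Fintype ι] (x : ι → box a b) (τ : ι → Fin q) : Config q a b :=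
  if h : Function.Injective x then ⟨colored x τ, pairwise_disjoint_colored h τ⟩
  else ⟨fun _ => ⟨∅⟩, fun _ _ _ => Finset.disjoint_empty_left _⟩

theorem coloredConfig_val {ι : Type*} [Fintype ι] {x : ι → box a b}
    (hx : Function.Injective x) (τ : ι → Fin q) : (coloredConfig x τ).1 = colored x τ := by
  rw [coloredConfig, dif_pos hx]

theorem measurableSet_injective {ι : Type*} [Fintype ι] :
    MeasurableSet {x : ι → box a b | Function.Injective x} := by
  have : {x : ι → box a b | Function.Injective x} =
      ⋂ i, ⋂ j, ⋂ _ : i ≠ j, {x | x i = x j}ᶜ := by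
    ext x
    simp only [Set.mem_ofPred_eq, Set.mem_iInter, Set.mem_compl_iff, Function.Injective]
    exact forall_congr' fun i => forall_congr' fun j => by tauto
  rw [this]
  exact MeasurableSet.iInter fun i => MeasurableSet.iInter fun j => MeasurableSet.iInter fun _ =>
    (measurableSet_eq_fun (measurable_pi_apply i) (measurable_pi_apply j)).compl

theorem measurable_coloredConfig {ι : Type*} [Fintype ι] (τ : ι → Fin q) :
    Measurable fun x : ι → box a b => coloredConfig x τ := by
  have h : Measurable fun x : ι → box a b => (coloredConfig x τ).1 := by
    have e : (fun x : ι → box a b => (coloredConfig x τ).1) =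
        fun x => if Function.Injective x then colored x τ else fun _ => ⟨∅⟩ := by
      funext x
      rw [coloredConfig]
      split_ifs <;> rfl
    rw [e]
    exact Measurable.ite measurableSet_injective (measurable_colored τ) measurable_const
  exact h.subtype_mk (h := fun x => (coloredConfig x τ).2)

variable [NeZero d] [Nonempty (box a b)]

/-- Puts the positions outside and the types inside as a finite sum, so that statements about types
can be proved at fixed, almost surely distinct, positions. -/
theorem lintegral_gibbsUnnormalized_eq_tsum (z T : ℝ) {f : Config q a b → ℝ≥0∞}
    (hf : Measurable f) :
    ∫⁻ c, f c ∂gibbsUnnormalized q a b z T = ∑' n : ℕ, (n.factorial : ℝ≥0∞)⁻¹ *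
      ∫⁻ x : Fin n → box a b, ∑ τ : Fin n → Fin q,
        ENNReal.ofReal (gibbsWeight z T (coloredConfig x τ)) * f (coloredConfig x τ)
          ∂Measure.pi fun _ => boxVolume a b := by
  have hg : Measurable fun c => ENNReal.ofReal (gibbsWeight z T c) * f c :=
    (measurable_gibbsWeight z T).ennreal_ofReal.mul hf
  rw [lintegral_gibbsUnnormalized z T hf, pi_lebesguePoisson, lintegral_sum_measure]
  refine tsum_congr fun n => ?_
  rw [lintegral_smul_measure, smul_eq_mul, lintegral_finsetSum_measure, lintegral_finsetSum]
  · congr 1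
    refine Finset.sum_congr rfl fun τ _ => ?_
    rw [lintegral_map (measurable_extendZero hg) (measurable_colored τ)]
    refine lintegral_congr_ae ?_
    filter_upwards [ae_pi_injective (ι := Fin n) (boxVolume a b)] with x hx
    rw [← coloredConfig_val hx, extendZero_val]
  · exact fun τ _ => hg.comp (measurable_coloredConfig τ)

end Master

/-! ### The Edwards–Sokal coupling on a finite set -/

section Coloring

variable {ι ι' : Type*} [Fintype ι] [Fintype ι'] {q : ℕ}

/-- The pairs of distinct indices of the same colour. -/
def monoPairs (τ : ι → Fin q) : Finset (Sym2 ι) :=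
  Finset.univ.filter fun e => ¬ e.IsDiag ∧ (e.map τ).IsDiag

theorem mk_mem_monoPairs {τ : ι → Fin q} {i j : ι} :
    s(i, j) ∈ monoPairs τ ↔ i ≠ j ∧ τ i = τ j := by
  simp [monoPairs]

/-- The pairs of distinct indices. -/
def distinctPairs (ι : Type*) [Fintype ι] : Finset (Sym2 ι) :=
  Finset.univ.filter fun e => ¬ e.IsDiag

theorem monoPairs_subset (τ : ι → Fin q) : monoPairs τ ⊆ distinctPairs ι := fun e he => by
  simp only [monoPairs, Finset.mem_filter] at he
  simp [distinctPairs, he.2.1]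

/-- The colorings that are constant on the clusters of the graph with edge set `E`. -/
def compatible (q : ℕ) (E : Finset (Sym2 ι)) : Finset (ι → Fin q) :=
  Finset.univ.filter fun τ => E ⊆ monoPairs τ

theorem mem_compatible {E : Finset (Sym2 ι)} {τ : ι → Fin q} :
    τ ∈ compatible q E ↔ E ⊆ monoPairs τ := by simp [compatible]

/-- The bijection of unordered pairs that is induced by a bijection. -/
def pairEquiv (e : ι ≃ ι') : Sym2 ι ≃ Sym2 ι' where
  toFun := Sym2.map e
  invFun := Sym2.map e.symm
  left_inv p := by simp [Sym2.map_map]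
  right_inv p := by simp [Sym2.map_map]

theorem pairEquiv_mem_monoPairs (e : ι ≃ ι') (τ : ι' → Fin q) (p : Sym2 ι) :
    pairEquiv e p ∈ monoPairs τ ↔ p ∈ monoPairs (τ ∘ e) := by
  induction p with
  | _ i j => simp [pairEquiv, mk_mem_monoPairs]

theorem map_monoPairs (e : ι ≃ ι') (τ : ι' → Fin q) :
    (monoPairs (τ ∘ e)).map (pairEquiv e).toEmbedding = monoPairs τ := by
  ext p
  obtain ⟨p, rfl⟩ := (pairEquiv e).surjective p
  rw [pairEquiv_mem_monoPairs]
  exact Finset.mem_map' (pairEquiv e).toEmbedding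

theorem map_subset_monoPairs_iff (e : ι ≃ ι') (τ : ι' → Fin q) (E : Finset (Sym2 ι)) :
    E.map (pairEquiv e).toEmbedding ⊆ monoPairs τ ↔ E ⊆ monoPairs (τ ∘ e) := by
  rw [← map_monoPairs e τ, Finset.map_subset_map]

/-- The probability of the edge set `E` when the pairs of points of the same colour are joined
independently with probability `p`. -/
def edgeWeight (p : Sym2 ι → ℝ) (τ : ι → Fin q) (E : Finset (Sym2 ι)) : ℝ≥0∞ :=
  (∏ e ∈ E, ENNReal.ofReal (p e)) * ∏ e ∈ monoPairs τ \ E, ENNReal.ofReal (1 - p e)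

/-- The sum over edge sets is the expanded product of the factors `p e + (1 - p e)`. -/
theorem sum_edgeWeight {p : Sym2 ι → ℝ} (hp : ∀ e, p e ∈ Set.Icc (0 : ℝ) 1) (τ : ι → Fin q) :
    ∑ E ∈ (monoPairs τ).powerset, edgeWeight p τ E = 1 := by
  simp only [edgeWeight]
  rw [← Finset.prod_add]
  refine Finset.prod_eq_one fun e _ => ?_
  rw [← ENNReal.ofReal_add (hp e).1 (by linarith [(hp e).2])]
  simp

/-- The crux of the coupling: pairs of different colours contribute `1 - p` through the Potts
weight, closed pairs of equal colour through the edge probability, so the product depends on `E`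
alone. -/
theorem edgeWeight_mul {p : Sym2 ι → ℝ} (τ : ι → Fin q) {E : Finset (Sym2 ι)}
    (hE : E ⊆ monoPairs τ) :
    (∏ e ∈ distinctPairs ι \ monoPairs τ, ENNReal.ofReal (1 - p e)) * edgeWeight p τ E =
      (∏ e ∈ E, ENNReal.ofReal (p e)) * ∏ e ∈ distinctPairs ι \ E, ENNReal.ofReal (1 - p e) := by
  have h : distinctPairs ι \ E = (distinctPairs ι \ monoPairs τ) ∪ (monoPairs τ \ E) := by
    ext e
    have h1 := @monoPairs_subset ι _ q τ e
    have h2 := @hE e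
    simp only [Finset.mem_sdiff, Finset.mem_union]
    tauto
  rw [h, Finset.prod_union, edgeWeight]
  · ring
  · rw [Finset.disjoint_left]
    intro e h1 h2
    exact (Finset.mem_sdiff.1 h1).2 (Finset.mem_sdiff.1 h2).1

/-- The empty set is a separate case because an edge set may have no compatible coloring, for
instance if it contains a loop. -/
theorem card_mul_sum_inv_card {β : Type*} (s : Finset β) (f : β → ℝ≥0∞) :
    (s.card : ℝ≥0∞) * ∑ x ∈ s, (s.card : ℝ≥0∞)⁻¹ * f x = ∑ x ∈ s, f x := by
  rcases s.eq_empty_or_nonempty with rfl | hs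
  · simp
  · rw [← Finset.mul_sum, ← mul_assoc, ENNReal.mul_inv_cancel, one_mul]
    · simpa using hs.ne_empty
    · exact ENNReal.natCast_ne_top _

/-- The Edwards–Sokal identity: drawing edges between points of the same colour and recoloring
the clusters uniformly preserves the Potts weights. -/
theorem sum_edwardsSokal {p : Sym2 ι → ℝ} (hp : ∀ e, p e ∈ Set.Icc (0 : ℝ) 1)
    (f : (ι → Fin q) → ℝ≥0∞) :
    ∑ τ : ι → Fin q, (∏ e ∈ distinctPairs ι \ monoPairs τ, ENNReal.ofReal (1 - p e)) *
        ∑ E ∈ (monoPairs τ).powerset, edgeWeight p τ E *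
          ∑ τ' ∈ compatible q E, ((compatible q E).card : ℝ≥0∞)⁻¹ * f τ' =
      ∑ τ : ι → Fin q, (∏ e ∈ distinctPairs ι \ monoPairs τ, ENNReal.ofReal (1 - p e)) * f τ := by
  set W : Finset (Sym2 ι) → ℝ≥0∞ := fun E =>
    (∏ e ∈ E, ENNReal.ofReal (p e)) * ∏ e ∈ distinctPairs ι \ E, ENNReal.ofReal (1 - p e) with hW
  have hcomm : ∀ g : (ι → Fin q) → Finset (Sym2 ι) → ℝ≥0∞,
      ∑ τ : ι → Fin q, ∑ E ∈ (monoPairs τ).powerset, g τ E =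
      ∑ E : Finset (Sym2 ι), ∑ τ ∈ compatible q E, g τ E := by
    intro g
    refine Finset.sum_comm' fun τ E => ?_
    simp [mem_compatible]
  calc _ = ∑ τ : ι → Fin q, ∑ E ∈ (monoPairs τ).powerset, W E *
          ∑ τ' ∈ compatible q E, ((compatible q E).card : ℝ≥0∞)⁻¹ * f τ' := by
        refine Finset.sum_congr rfl fun τ _ => ?_
        rw [Finset.mul_sum]
        refine Finset.sum_congr rfl fun E hE => ?_
        rw [← mul_assoc, edgeWeight_mul τ (Finset.mem_powerset.1 hE)]
    _ = ∑ E : Finset (Sym2 ι), ∑ τ ∈ compatible q E, W E * f τ := by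
        -- With `E` outside, the recoloring average does not depend on `τ`, so summing over the
        -- compatible `τ` cancels the inverse cardinality.
        rw [hcomm]
        refine Finset.sum_congr rfl fun E _ => ?_
        rw [Finset.sum_const, nsmul_eq_mul, mul_left_comm, card_mul_sum_inv_card, Finset.mul_sum]
    _ = ∑ τ : ι → Fin q, ∑ E ∈ (monoPairs τ).powerset, W E * f τ := (hcomm _).symm
    _ = _ := by
        refine Finset.sum_congr rfl fun τ _ => ?_
        rw [← Finset.sum_mul]
        congr 1
        rw [← mul_one (∏ e ∈ distinctPairs ι \ monoPairs τ, ENNReal.ofReal (1 - p e)),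
          ← sum_edgeWeight hp τ, Finset.mul_sum]
        exact Finset.sum_congr rfl fun E hE => (edgeWeight_mul τ (Finset.mem_powerset.1 hE)).symm

/-- A coloring constant along edges is constant along walks, hence descends to the components. Loops
are excluded by `hE`: the graph ignores them, but `compatible` would reject them. -/
theorem sum_clusters_eq {M : Type*} [AddCommMonoid M] {E : Finset (Sym2 ι)}
    (hE : E ⊆ distinctPairs ι)
    [Fintype ((SimpleGraph.fromEdgeSet (E : Set (Sym2 ι))).ConnectedComponent → Fin q)]
    (g : (ι → Fin q) → M) :
    ∑ κ : (SimpleGraph.fromEdgeSet (E : Set (Sym2 ι))).ConnectedComponent → Fin q,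
      g (fun i => κ ((SimpleGraph.fromEdgeSet (E : Set (Sym2 ι))).connectedComponentMk i)) =
      ∑ τ ∈ compatible q E, g τ := by
  refine Finset.sum_bij (fun κ _ i =>
    κ ((SimpleGraph.fromEdgeSet (E : Set (Sym2 ι))).connectedComponentMk i)) ?_ ?_ ?_ ?_
  · intro κ _
    rw [mem_compatible]
    intro e he
    induction e with
    | _ i j =>
      have hij : i ≠ j := by
        have := hE he
        simpa [distinctPairs] using this
      refine mk_mem_monoPairs.2 ⟨hij, congrArg κ ?_⟩
      apply SimpleGraph.ConnectedComponent.connectedComponentMk_eq_of_adj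
      rw [SimpleGraph.fromEdgeSet_adj]
      exact ⟨he, hij⟩
  · intro κ _ κ' _ h
    funext C
    induction C using SimpleGraph.ConnectedComponent.ind with
    | _ v => exact congrFun h v
  · intro τ hτ
    rw [mem_compatible] at hτ
    have hw : ∀ (v w : ι) (_ : (SimpleGraph.fromEdgeSet (E : Set (Sym2 ι))).Walk v w),
        τ v = τ w := by
      intro v w p
      induction p with
      | nil => rfl
      | cons h p ih =>
        rw [SimpleGraph.fromEdgeSet_adj] at h
        exact (mk_mem_monoPairs.1 (hτ (Finset.mem_coe.1 h.1))).2.trans ih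
    exact ⟨SimpleGraph.ConnectedComponent.lift τ fun v w p _ => hw v w p, Finset.mem_univ _, rfl⟩
  · intro κ _; rfl

end Coloring

/-! ### Edges and recoloring for labelled points -/

section Draw

variable {d q : ℕ} {a b : Fin d → ℝ} {ι ι' : Type*}

/-- The probability of an edge between two of the points `x i`. -/
def pairProb (T : ℝ) (x : ι → box a b) (e : Sym2 ι) : ℝ :=
  Sym2.lift ⟨fun i j => 1 - boltzmann T (potential (x i) (x j)),
    fun i j => by simp only [potential_comm (x i) (x j)]⟩ e

theorem pairProb_mem {T : ℝ} (hT : 0 ≤ T) (x : ι → box a b) (e : Sym2 ι) :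
    pairProb T x e ∈ Set.Icc (0 : ℝ) 1 := by
  induction e with
  | _ i j =>
    simp only [pairProb, Sym2.lift_mk]
    have h1 := boltzmann_nonneg T (potential (x i) (x j))
    have h2 := boltzmann_le_one hT (potential_nonneg (x i) (x j))
    constructor <;> linarith

variable [Fintype ι] [Fintype ι']

/-- The law of the configuration after drawing edges and recoloring the clusters, in terms of
labelled points. -/
def recolorLaw (T : ℝ) (x : ι → box a b) (τ : ι → Fin q) : Measure (Config q a b) :=
  ∑ E ∈ (monoPairs τ).powerset, edgeWeight (pairProb T x) τ E •
    ∑ τ' ∈ compatible q E, ((compatible q E).card : ℝ≥0∞)⁻¹ • Measure.dirac (coloredConfig x τ')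

theorem coloredConfig_comp (e : ι ≃ ι') (x : ι' → box a b) (τ : ι' → Fin q) :
    coloredConfig (x ∘ e) (τ ∘ e) = coloredConfig x τ := by
  by_cases hx : Function.Injective x
  · apply Subtype.ext
    rw [coloredConfig_val hx, coloredConfig_val (hx.comp e.injective)]
    funext s
    ext y
    simp only [mem_colored, Function.comp]
    exact e.exists_congr_left.trans (by simp)
  · have hx' : ¬ Function.Injective (x ∘ e) := fun h => hx <| by
      simpa [Function.comp_assoc] using h.comp e.symm.injective
    rw [coloredConfig, coloredConfig, dif_neg hx, dif_neg hx']

/-- Independence of the labelling, needed because the kernel is indexed by the occupied positions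
themselves, while the integrals are indexed by `Fin n`. -/
theorem recolorLaw_comp (T : ℝ) (e : ι ≃ ι') (x : ι' → box a b) (τ : ι' → Fin q) :
    recolorLaw T (x ∘ e) (τ ∘ e) = recolorLaw T x τ := by
  have hprob : ∀ p, pairProb T (x ∘ e) p = pairProb T x (pairEquiv e p) := by
    intro p
    induction p with
    | _ i j => rfl
  have hcompat : ∀ (E : Finset (Sym2 ι)) (τ' : ι' → Fin q),
      τ' ∈ compatible q (E.map (pairEquiv e).toEmbedding) ↔ τ' ∘ e ∈ compatible q E := by
    intro E τ'
    rw [mem_compatible, mem_compatible, map_subset_monoPairs_iff]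
  refine Finset.sum_equiv (Equiv.finsetCongr (pairEquiv e)) ?_ ?_
  · intro E
    simp only [Finset.mem_powerset, Equiv.finsetCongr_apply, map_subset_monoPairs_iff]
  · intro E _
    have hcard : (compatible q (E.map (pairEquiv e).toEmbedding)).card =
        (compatible q E).card := by
      refine Finset.card_equiv (e.symm.arrowCongr (Equiv.refl _)) fun τ' => ?_
      rw [hcompat]
      rfl
    rw [Equiv.finsetCongr_apply, hcard]
    congr 1
    · simp only [edgeWeight]
      rw [← map_monoPairs e τ, ← Finset.map_sdiff, Finset.prod_map, Finset.prod_map]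
      simp only [hprob]
      rfl
    · symm
      refine Finset.sum_equiv (e.symm.arrowCongr (Equiv.refl _)) ?_ ?_
      · intro τ'
        rw [hcompat]
        rfl
      · intro τ' _
        rw [← coloredConfig_comp e x τ']
        rfl

/-- Transport `x` and `τ` along the bijection `e` to the occupied positions, where the labelled and
the original description agree edge set by edge set. -/
theorem drawEdgesAndChooseTypes_coloredConfig {T : ℝ} (hT : 0 ≤ T) {x : ι → box a b}
    (hx : Function.Injective x) (τ : ι → Fin q) :
    drawEdgesAndChooseTypes T (coloredConfig x τ) = recolorLaw T x τ := by
  set c := coloredConfig x τ with hc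
  have hcv : ∀ s, (c.1 s) = colored x τ s := fun s => by rw [hc, coloredConfig_val hx]
  have hmem : ∀ y, y ∈ positions c ↔ ∃ i, x i = y := by
    intro y
    simp only [positions, Finset.mem_biUnion, Finset.mem_univ, true_and, hcv, mem_colored]
    exact ⟨fun ⟨s, i, _, h⟩ => ⟨i, h⟩, fun ⟨i, h⟩ => ⟨τ i, i, rfl, h⟩⟩
  let e : ι ≃ positions c := Equiv.ofBijective (fun i => ⟨x i, (hmem _).2 ⟨i, rfl⟩⟩)
    ⟨fun i j hij => hx (congrArg Subtype.val hij), fun ⟨y, hy⟩ => by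
      obtain ⟨i, hi⟩ := (hmem y).1 hy
      exact ⟨i, Subtype.ext hi⟩⟩
  have hxe : x = (Subtype.val : positions c → box a b) ∘ e := rfl
  obtain ⟨σ, hσ⟩ : ∃ σ : positions c → Fin q, τ = σ ∘ e := ⟨τ ∘ e.symm, by
    funext i; simp⟩
  have hcσ : c = coloredConfig (Subtype.val : positions c → box a b) σ := by
    rw [← coloredConfig_comp e, ← hσ, ← hxe]
  have hσmem : ∀ (y : positions c) s, y.1 ∈ (c.1 s).pts ↔ σ y = s := by
    intro y s
    obtain ⟨i, rfl⟩ := e.surjective y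
    rw [hcv, mem_colored, hσ]
    constructor
    · rintro ⟨j, hj, hij⟩
      rw [← hj]
      exact congrArg σ (congrArg e (hx hij)).symm
    · intro h
      exact ⟨i, h, rfl⟩
  have hpairs : sameTypePairs c = monoPairs σ := by
    ext p
    induction p with
    | _ y y' =>
      rw [mk_mem_monoPairs]
      simp only [sameTypePairs, Finset.mem_filter, Finset.mem_univ, true_and, Sym2.mk_isDiag_iff,
        Sym2.mem_iff, forall_eq_or_imp, forall_eq, hσmem]
      refine and_congr_right fun _ => ⟨fun ⟨s, h, h'⟩ => h.trans h'.symm, fun h => ⟨_, rfl, h.symm⟩⟩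
  have hp : ∀ p : Sym2 (positions c), edgeProb T p = pairProb T Subtype.val p := by
    intro p
    induction p with
    | _ i j => rfl
  have h01 := pairProb_mem hT (Subtype.val : positions c → box a b)
  conv_rhs => rw [hxe, hσ]
  rw [recolorLaw_comp, recolorLaw, drawEdgesAndChooseTypes, hpairs]
  refine Finset.sum_congr rfl fun E hE => ?_
  have hE' := (Finset.mem_powerset.1 hE).trans (monoPairs_subset σ)
  congr 1
  · rw [edgeSetProb, edgeWeight, hpairs, ENNReal.ofReal_mul, ENNReal.ofReal_prod_of_nonneg,
      ENNReal.ofReal_prod_of_nonneg]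
    · simp only [hp]
      congr!
    · intro p _; rw [hp]; linarith [(h01 p).2]
    · intro p _; rw [hp]; exact (h01 p).1
    · exact Finset.prod_nonneg fun p _ => by rw [hp]; exact (h01 p).1
  · have hcol : ∀ κ : (SimpleGraph.fromEdgeSet (E : Set (Sym2 (positions c)))).ConnectedComponent →
        Fin q, colorClusters (SimpleGraph.fromEdgeSet (E : Set (Sym2 (positions c)))) κ =
        coloredConfig Subtype.val (fun i => κ
          ((SimpleGraph.fromEdgeSet (E : Set (Sym2 (positions c)))).connectedComponentMk i)) := by
      intro κ
      apply Subtype.ext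
      rw [coloredConfig_val Subtype.val_injective]
      funext s
      ext y
      rw [mem_colored]
      simp [colorClusters]
    -- Counting through `sum_clusters_eq`: there are `q` to the number of clusters compatible
    -- colorings.
    have hcard : ((q : ℝ≥0∞)⁻¹) ^ Fintype.card
        (SimpleGraph.fromEdgeSet (E : Set (Sym2 (positions c)))).ConnectedComponent =
        ((compatible q E).card : ℝ≥0∞)⁻¹ := by
      have h := sum_clusters_eq hE' (q := q) (fun _ => 1)
      rw [Finset.sum_const, Finset.sum_const, smul_eq_mul, smul_eq_mul, mul_one, mul_one,
        Finset.card_univ, Fintype.card_fun, Fintype.card_fin] at h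
      rw [← h]
      push_cast
      rw [ENNReal.inv_pow]
    rw [chooseTypes, hcard]
    simp_rw [hcol]
    exact sum_clusters_eq hE'
      (fun τ' => ((compatible q E).card : ℝ≥0∞)⁻¹ • Measure.dirac (coloredConfig Subtype.val τ'))

end Draw

/-! ### Measurability and invariance of the recoloring kernel; the partition function -/

section DrawKernel

variable {d q : ℕ} {a b : Fin d → ℝ}

theorem recolorLaw_apply {ι : Type*} [Fintype ι] (T : ℝ) (x : ι → box a b) (τ : ι → Fin q)
    {A : Set (Config q a b)} (hA : MeasurableSet A) :
    recolorLaw T x τ A = ∑ E ∈ (monoPairs τ).powerset, edgeWeight (pairProb T x) τ E *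
      ∑ τ' ∈ compatible q E, ((compatible q E).card : ℝ≥0∞)⁻¹ *
        A.indicator 1 (coloredConfig x τ') := by
  simp only [recolorLaw, Measure.finsetSum_apply, Measure.smul_apply, smul_eq_mul,
    Measure.dirac_apply' _ hA]

theorem recolorLaw_eq_one {ι : Type*} [Fintype ι] {T : ℝ} (hT : 0 ≤ T) (x : ι → box a b)
    (τ : ι → Fin q) {A : Set (Config q a b)} (hA : MeasurableSet A)
    (h : ∀ τ' : ι → Fin q, coloredConfig x τ' ∈ A) : recolorLaw T x τ A = 1 := by
  rw [recolorLaw_apply T x τ hA, ← sum_edgeWeight (pairProb_mem hT x) τ]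
  refine Finset.sum_congr rfl fun E hE => ?_
  have hne : (compatible q E).card ≠ 0 := Finset.card_ne_zero_of_mem (a := τ)
    (mem_compatible.2 (Finset.mem_powerset.1 hE))
  simp only [Set.indicator_of_mem (h _), Pi.one_apply, mul_one, Finset.sum_const, nsmul_eq_mul]
  rw [ENNReal.mul_inv_cancel (by exact_mod_cast hne) (ENNReal.natCast_ne_top _), mul_one]

theorem measurable_recolorLaw {ι : Type*} [Fintype ι] (T : ℝ) (τ : ι → Fin q) :
    Measurable fun x : ι → box a b => recolorLaw T x τ := by
  refine Measure.measurable_of_measurable_coe _ fun A hA => ?_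
  simp_rw [recolorLaw_apply T _ τ hA]
  have hp : ∀ e : Sym2 ι, Measurable fun x : ι → box a b => pairProb T x e := by
    intro e
    induction e with
    | _ i j =>
      have h : Measurable fun x : ι → box a b => (x i, x j) := by fun_prop
      have h' := (measurable_boltzmann T).comp (measurable_potential.comp h)
      exact measurable_const.sub h'
  refine Finset.measurable_sum _ fun E _ => Measurable.mul (Measurable.mul ?_ ?_) ?_
  · exact Finset.measurable_prod _ fun e _ => (hp e).ennreal_ofReal
  · exact Finset.measurable_prod _ fun e _ => (measurable_const.sub (hp e)).ennreal_ofReal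
  · refine Finset.measurable_sum _ fun τ' _ => Measurable.const_mul ?_ _
    have hA1 : Measurable (A.indicator (1 : Config q a b → ℝ≥0∞)) := measurable_one.indicator hA
    have h := hA1.comp (measurable_coloredConfig τ')
    exact h

/-- The Boltzmann factor is multiplicative over pairs of particles of different types, and for one
pair it is one minus the edge probability. -/
theorem potts_weight_eq {ι : Type*} [Fintype ι] {T : ℝ} {x : ι → box a b}
    (hx : Function.Injective x) (τ : ι → Fin q) :
    boltzmann T (hamiltonian (coloredConfig x τ)) =
      ∏ e ∈ distinctPairs ι \ monoPairs τ, (1 - pairProb T x e) := by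
  set F : ι → ι → ℝ := fun i j => boltzmann T (potential (x i) (x j)) with hF
  have hsub : ∀ (s : Fin q) (g : ι → ℝ), ∏ i : {i // τ i = s}, g i =
      ∏ i, if τ i = s then g i else 1 := by
    intro s g
    rw [← Finset.prod_filter]
    exact (Finset.prod_subtype _ (by simp) g).symm
  have h1 : boltzmann T (hamiltonian (coloredConfig x τ)) =
      ∏ s : Fin q, ∏ t ∈ Finset.Ioi s, ∏ i : {i // τ i = s}, ∏ j : {j // τ j = t}, F i j := by
    have hinj : ∀ s, Function.Injective fun i : {i // τ i = s} => x i := fun s =>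
      hx.comp Subtype.val_injective
    have n2 : ∀ (X : Finset (box a b)) y, 0 ≤ ∑ y' ∈ X, potential y y' := fun X y =>
      Finset.sum_nonneg fun y' _ => potential_nonneg y y'
    rw [hamiltonian, boltzmann_sum _ _ fun s _ => Finset.sum_nonneg fun t _ =>
      Finset.sum_nonneg fun y _ => n2 _ _]
    refine Finset.prod_congr rfl fun s _ => ?_
    rw [boltzmann_sum _ _ fun t _ => Finset.sum_nonneg fun y _ => n2 _ _]
    refine Finset.prod_congr rfl fun t _ => ?_
    rw [boltzmann_sum _ _ fun y _ => n2 _ _, coloredConfig_val hx, colored,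
      prod_ofTuple (hinj s)]
    refine Finset.prod_congr rfl fun i _ => ?_
    rw [boltzmann_sum _ _ fun y _ => potential_nonneg _ _, colored, prod_ofTuple (hinj t)]
  have h2 : ∏ s : Fin q, ∏ t ∈ Finset.Ioi s, ∏ i : {i // τ i = s}, ∏ j : {j // τ j = t}, F i j =
      ∏ p ∈ Finset.univ.filter (fun p : ι × ι => τ p.1 < τ p.2), F p.1 p.2 := by
    rw [Finset.prod_filter, Fintype.prod_prod_type]
    have h3 : ∀ s : Fin q, ∏ t ∈ Finset.Ioi s, ∏ i : {i // τ i = s}, ∏ j : {j // τ j = t}, F i j =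
        ∏ i, if τ i = s then ∏ j, (if s < τ j then F i j else 1) else 1 := by
      intro s
      rw [Finset.prod_congr rfl fun t _ => hsub s fun i => ∏ j : {j // τ j = t}, F i j,
        Finset.prod_comm]
      refine Finset.prod_congr rfl fun i _ => ?_
      by_cases hi : τ i = s
      · simp only [hi, if_true]
        rw [Finset.prod_congr rfl fun t _ => hsub t (F i), Finset.prod_comm]
        refine Finset.prod_congr rfl fun j _ => ?_
        rw [Finset.prod_ite_eq]
        simp
      · simp [hi]
    rw [Finset.prod_congr rfl fun s _ => h3 s]
    rw [Finset.prod_comm]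
    refine Finset.prod_congr rfl fun i _ => ?_
    rw [Finset.prod_ite_eq]
    simp
  rw [h1, h2]
  -- Each unordered pair of different colours is ordered in exactly one way with the smaller colour
  -- first.
  refine Finset.prod_bij (fun p _ => s(p.1, p.2)) ?_ ?_ ?_ ?_
  · rintro ⟨i, j⟩ h
    have h : τ i < τ j := by simpa using h
    rw [Finset.mem_sdiff, mk_mem_monoPairs]
    refine ⟨?_, fun h' => h.ne h'.2⟩
    have : i ≠ j := fun hij => h.ne (congrArg τ hij)
    simpa [distinctPairs] using this
  · rintro ⟨i, j⟩ h ⟨k, l⟩ h' he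
    have h : τ i < τ j := by simpa using h
    have h' : τ k < τ l := by simpa using h'
    rcases Sym2.eq_iff.1 he with ⟨rfl, rfl⟩ | ⟨rfl, rfl⟩
    · rfl
    · exact absurd h h'.not_gt
  · intro e he
    induction e with
    | _ i j =>
      rw [Finset.mem_sdiff, mk_mem_monoPairs] at he
      have hij : i ≠ j := by simpa [distinctPairs] using he.1
      have hτ : τ i ≠ τ j := fun h => he.2 ⟨hij, h⟩
      rcases hτ.lt_or_gt with h | h
      · exact ⟨(i, j), by simpa using h, rfl⟩
      · exact ⟨(j, i), by simpa using h, Sym2.eq_swap⟩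
  · rintro ⟨i, j⟩ _
    simp [pairProb, hF]

theorem gibbsWeight_coloredConfig {ι : Type*} [Fintype ι] {z T : ℝ} {x : ι → box a b}
    (hx : Function.Injective x) (τ : ι → Fin q) :
    gibbsWeight z T (coloredConfig x τ) = z ^ Fintype.card ι *
      ∏ e ∈ distinctPairs ι \ monoPairs τ, (1 - pairProb T x e) := by
  rw [gibbsWeight, potts_weight_eq hx, mul_comm, Finset.prod_pow_eq_pow_sum]
  congr 2
  rw [← Fintype.card_congr (Equiv.sigmaFiberEquiv τ), Fintype.card_sigma]
  refine Finset.sum_congr rfl fun s _ => ?_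
  rw [coloredConfig_val hx, colored]
  exact card_ofTuple (hx.comp Subtype.val_injective)

theorem measurableSet_empty_types (S : Finset (Fin q)) :
    MeasurableSet {c : Config q a b | ∀ s ∈ S, (c.1 s).pts = ∅} := by
  simp only [Set.ofPred_forall]
  exact MeasurableSet.iInter fun s => MeasurableSet.iInter fun _ =>
    measurable_config_apply s measurableSet_pts_eq_empty

variable [Nonempty (box a b)]

/-- The points of a configuration, in a measurable enumeration. -/
def enumerate (m : Fin q → ℕ) (c : Config q a b) (i : Σ s, Fin (m s)) : box a b :=
  nthPoint (c.1 i.1) i.2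

theorem measurable_enumerate (m : Fin q → ℕ) :
    Measurable (enumerate m : Config q a b → (Σ s, Fin (m s)) → box a b) :=
  measurable_pi_lambda _ fun i => (measurable_nthPoint i.2).comp (measurable_config_apply i.1)

theorem injective_enumerate {m : Fin q → ℕ} {c : Config q a b}
    (h : ∀ s, (c.1 s).pts.card = m s) : Function.Injective (enumerate m c) := by
  rintro ⟨s, i⟩ ⟨t, j⟩ hij
  have hmem : ∀ s (i : Fin (m s)), nthPoint (c.1 s) i ∈ (c.1 s).pts := fun s i =>
    exists_nthPoint_eq.2 ⟨i, (h s).symm ▸ i.2, rfl⟩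
  have hst : s = t := by
    by_contra hst
    have h1 := hmem s i
    have h2 := hmem t j
    have hij : nthPoint (c.1 s) i = nthPoint (c.1 t) j := hij
    rw [hij] at h1
    exact Finset.disjoint_left.1 (c.2 hst) h1 h2
  subst hst
  exact congrArg _ (injective_nthPoint (h s) hij)

theorem coloredConfig_enumerate {m : Fin q → ℕ} {c : Config q a b}
    (h : ∀ s, (c.1 s).pts.card = m s) : coloredConfig (enumerate m c) Sigma.fst = c := by
  apply Subtype.ext
  rw [coloredConfig_val (injective_enumerate h)]
  funext s
  ext y
  rw [mem_colored, exists_nthPoint_eq]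
  constructor
  · rintro ⟨⟨t, i⟩, rfl, hy⟩
    exact ⟨i, (h t).symm ▸ i.2, hy⟩
  · rintro ⟨k, hk, hy⟩
    exact ⟨⟨s, ⟨k, h s ▸ hk⟩⟩, rfl, hy⟩

theorem drawEdgesAndChooseTypes_eq {T : ℝ} (hT : 0 ≤ T) {m : Fin q → ℕ} {c : Config q a b}
    (h : ∀ s, (c.1 s).pts.card = m s) :
    drawEdgesAndChooseTypes T c = recolorLaw T (enumerate m c) Sigma.fst := by
  conv_lhs => rw [← coloredConfig_enumerate h]
  exact drawEdgesAndChooseTypes_coloredConfig hT (injective_enumerate h) _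

/-- There are countably many vectors `m` of particle numbers, and where `m` is fixed the kernel is a
measurable function of the enumerated points. -/
theorem measurable_drawEdgesAndChooseTypes {T : ℝ} (hT : 0 ≤ T) :
    Measurable (drawEdgesAndChooseTypes T : Config q a b → Measure (Config q a b)) := by
  intro S hS
  have : (drawEdgesAndChooseTypes T : Config q a b → Measure (Config q a b)) ⁻¹' S =
      ⋃ m : Fin q → ℕ, {c | ∀ s, (c.1 s).pts.card = m s} ∩
        {c | recolorLaw T (enumerate m c) Sigma.fst ∈ S} := by
    ext c
    simp only [Set.mem_preimage, Set.mem_iUnion, Set.mem_inter_iff, Set.mem_ofPred_eq]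
    constructor
    · intro h
      exact ⟨fun s => (c.1 s).pts.card, fun _ => rfl, by
        rwa [← drawEdgesAndChooseTypes_eq hT fun _ => rfl]⟩
    · rintro ⟨m, hm, h⟩
      rwa [drawEdgesAndChooseTypes_eq hT hm]
  rw [this]
  refine MeasurableSet.iUnion fun m => MeasurableSet.inter ?_ ?_
  · rw [Set.ofPred_forall]
    exact MeasurableSet.iInter fun s => (measurable_card.comp (measurable_config_apply s))
      (measurableSet_singleton (m s))
  · exact ((measurable_recolorLaw T _).comp (measurable_enumerate m)) hS

theorem isProbabilityMeasure_drawEdgesAndChooseTypes {T : ℝ} (hT : 0 ≤ T) (c : Config q a b) :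
    IsProbabilityMeasure (drawEdgesAndChooseTypes T c) := by
  rw [drawEdgesAndChooseTypes_eq hT fun _ => rfl]
  exact ⟨recolorLaw_eq_one hT _ _ MeasurableSet.univ fun _ => Set.mem_univ _⟩

theorem drawEdgesAndChooseTypes_empty {T : ℝ} (hT : 0 ≤ T) {c : Config q a b}
    (h : ∀ s, (c.1 s).pts = ∅) :
    drawEdgesAndChooseTypes T c {c' | ∀ s ∈ Finset.univ, (c'.1 s).pts = ∅} = 1 := by
  rw [drawEdgesAndChooseTypes_eq hT (m := fun _ => 0) fun s => by simp [h s]]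
  refine recolorLaw_eq_one hT _ _ (measurableSet_empty_types _) fun τ' s _ => ?_
  rw [coloredConfig_val (fun i => i.2.elim0)]
  ext y
  rw [mem_colored]
  simp

variable [NeZero d]

/-- At fixed distinct positions the factor `z ^ n` is common to all colorings, and what is left is
`sum_edwardsSokal`. -/
theorem gibbsUnnormalized_bind_draw {z T : ℝ} (hz : 0 < z) (hT : 0 ≤ T) :
    (gibbsUnnormalized q a b z T).bind (drawEdgesAndChooseTypes T) =
      gibbsUnnormalized q a b z T := by
  have hm := measurable_drawEdgesAndChooseTypes (q := q) (a := a) (b := b) hT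
  ext A hA
  have hA1 : Measurable (A.indicator (1 : Config q a b → ℝ≥0∞)) := measurable_one.indicator hA
  have hmA : Measurable fun c => drawEdgesAndChooseTypes T c A :=
    (Measure.measurable_coe hA).comp hm
  rw [Measure.bind_apply hA hm.aemeasurable,
    lintegral_gibbsUnnormalized_eq_tsum z T hmA,
    ← lintegral_indicator_one hA, lintegral_gibbsUnnormalized_eq_tsum z T hA1]
  refine tsum_congr fun n => ?_
  congr 1
  refine lintegral_congr_ae ?_
  filter_upwards [ae_pi_injective (ι := Fin n) (boxVolume a b)] with x hx
  have hp := pairProb_mem hT x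
  have hw : ∀ τ : Fin n → Fin q, ENNReal.ofReal (gibbsWeight z T (coloredConfig x τ)) =
      ENNReal.ofReal (z ^ Fintype.card (Fin n)) *
        ∏ e ∈ distinctPairs (Fin n) \ monoPairs τ, ENNReal.ofReal (1 - pairProb T x e) := by
    intro τ
    rw [gibbsWeight_coloredConfig hx, ENNReal.ofReal_mul (by positivity),
      ENNReal.ofReal_prod_of_nonneg fun e _ => by linarith [(hp e).2]]
    congr!
  simp only [hw, mul_assoc, drawEdgesAndChooseTypes_coloredConfig hT hx, recolorLaw_apply T x _ hA]
  rw [← Finset.mul_sum, ← Finset.mul_sum]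
  congr 1
  convert sum_edwardsSokal hp fun τ => A.indicator 1 (coloredConfig x τ)

/-- Each of the `q ^ n` colorings of `n` points has weight at most `z ^ n`, which gives an
exponential series in `q z |Λ|`. -/
theorem gibbsUnnormalized_univ_lt_top {z T : ℝ} (hz : 0 < z) (hT : 0 ≤ T) :
    gibbsUnnormalized q a b z T Set.univ < ∞ := by
  rw [← lintegral_one, lintegral_gibbsUnnormalized_eq_tsum z T measurable_const]
  have hb : ∀ n : ℕ, (n.factorial : ℝ≥0∞)⁻¹ * ∫⁻ x : Fin n → box a b, ∑ τ : Fin n → Fin q,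
      ENNReal.ofReal (gibbsWeight z T (coloredConfig x τ)) * 1
        ∂Measure.pi (fun _ => boxVolume a b) ≤
      (n.factorial : ℝ≥0∞)⁻¹ * ENNReal.ofReal (q * z * volume.real (box a b)) ^ n := by
    intro n
    gcongr
    calc _ ≤ ∫⁻ _ : Fin n → box a b, ENNReal.ofReal (q * z) ^ n
            ∂Measure.pi (fun _ => boxVolume a b) := by
          refine lintegral_mono_ae ?_
          filter_upwards [ae_pi_injective (ι := Fin n) (boxVolume a b)] with x hx
          have hp := pairProb_mem hT x
          calc _ ≤ ∑ _τ : Fin n → Fin q, ENNReal.ofReal (z ^ n) := by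
                refine Finset.sum_le_sum fun τ _ => ?_
                rw [mul_one, gibbsWeight_coloredConfig hx, Fintype.card_fin]
                refine ENNReal.ofReal_le_ofReal (mul_le_of_le_one_right (by positivity) ?_)
                exact Finset.prod_le_one (fun e _ => by linarith [(hp e).2])
                  fun e _ => by linarith [(hp e).1]
            _ = ENNReal.ofReal (q * z) ^ n := by
                rw [Finset.sum_const, Finset.card_univ, Fintype.card_fun, Fintype.card_fin,
                  Fintype.card_fin, nsmul_eq_mul, ENNReal.ofReal_mul (by positivity), mul_pow,
                  ENNReal.ofReal_pow hz.le, ENNReal.ofReal_natCast]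
                push_cast
                rfl
      _ = _ := by
          rw [lintegral_const, Measure.pi_univ, boxVolume_univ, Finset.prod_const,
            Finset.card_univ, Fintype.card_fin, ← mul_pow, ENNReal.ofReal_mul (by positivity : 0 ≤ q * z),
            Measure.real, ENNReal.ofReal_toReal isBounded_box.measure_lt_top.ne]
  refine (ENNReal.tsum_le_tsum hb).trans_lt ?_
  rw [tsum_inv_factorial_mul_pow (by positivity)]
  exact ENNReal.ofReal_lt_top

theorem gibbsUnnormalized_univ_ne_zero {z T : ℝ} :
    gibbsUnnormalized q a b z T Set.univ ≠ 0 := by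
  rw [← lintegral_one, lintegral_gibbsUnnormalized_eq_tsum z T measurable_const]
  intro h
  -- The empty configuration alone contributes `1`.
  have h0 := ENNReal.tsum_eq_zero.1 h 0
  simp only [Nat.factorial_zero, Nat.cast_one, inv_one, one_mul, mul_one] at h0
  have hw : ∀ (x : Fin 0 → box a b) (τ : Fin 0 → Fin q),
      gibbsWeight z T (coloredConfig x τ) = 1 := by
    intro x τ
    rw [gibbsWeight_coloredConfig (Function.injective_of_subsingleton x)]
    have : distinctPairs (Fin 0) = ∅ := Finset.eq_empty_of_isEmpty _
    simp [this]
  simp [hw] at h0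

end DrawKernel

/-! ### Markov kernels and the Doeblin minorization -/

section Markov

variable {Ω : Type*} [MeasurableSpace Ω]

theorem isProbabilityMeasure_bind {K : Ω → Measure Ω} (hK : Measurable K)
    (hp : ∀ c, IsProbabilityMeasure (K c)) (ν : Measure Ω) [IsProbabilityMeasure ν] :
    IsProbabilityMeasure (ν.bind K) := by
  refine ⟨?_⟩
  rw [Measure.bind_apply MeasurableSet.univ hK.aemeasurable]
  simp

theorem add_bind {K : Ω → Measure Ω} (hK : Measurable K) (μ ν : Measure Ω) :
    (μ + ν).bind K = μ.bind K + ν.bind K := by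
  ext A hA
  rw [Measure.add_apply, Measure.bind_apply hA hK.aemeasurable,
    Measure.bind_apply hA hK.aemeasurable, Measure.bind_apply hA hK.aemeasurable,
    lintegral_add_measure]

theorem measurable_foldl_bind {S : Type*} {R : S → Ω → Measure Ω} (hR : ∀ s, Measurable (R s))
    (l : List S) :
    Measurable fun c => l.foldl (fun ν s => ν.bind (R s)) (Measure.dirac c) := by
  induction l using List.reverseRecOn with
  | nil => exact Measure.measurable_dirac
  | append_singleton l s ih =>
    simp only [List.foldl_append, List.foldl_cons, List.foldl_nil]
    exact (Measure.measurable_bind' (hR s)).comp ih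

/-- Resampling from a random start is the mixture of resamplings from deterministic starts. The
induction peels off the last kernel, where associativity of `bind` applies. -/
theorem foldl_bind_eq {S : Type*} {R : S → Ω → Measure Ω} (hR : ∀ s, Measurable (R s))
    (l : List S) (ν : Measure Ω) :
    ν.bind (fun c => l.foldl (fun ν s => ν.bind (R s)) (Measure.dirac c)) =
      l.foldl (fun ν s => ν.bind (R s)) ν := by
  induction l using List.reverseRecOn with
  | nil => exact Measure.bind_dirac
  | append_singleton l s ih =>
    simp only [List.foldl_append, List.foldl_cons, List.foldl_nil]
    rw [← ih, Measure.bind_bind (measurable_foldl_bind hR l).aemeasurable (hR s).aemeasurable]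

theorem isProbabilityMeasure_foldl_bind {S : Type*} {R : S → Ω → Measure Ω}
    (hR : ∀ s, Measurable (R s)) (hp : ∀ s c, IsProbabilityMeasure (R s c)) (l : List S)
    (ν : Measure Ω) [IsProbabilityMeasure ν] :
    IsProbabilityMeasure (l.foldl (fun ν s => ν.bind (R s)) ν) := by
  induction l generalizing ν with
  | nil => assumption
  | cons s l ih =>
    have := isProbabilityMeasure_bind (hR s) (hp s) ν
    exact ih _

theorem foldl_bind_of_invariant {S : Type*} {R : S → Ω → Measure Ω} {μ : Measure Ω}
    (h : ∀ s, μ.bind (R s) = μ) (l : List S) :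
    l.foldl (fun ν s => ν.bind (R s)) μ = μ := by
  induction l with
  | nil => rfl
  | cons s l ih => rw [List.foldl_cons, h s, ih]

theorem isProbabilityMeasure_iterate_bind {K : Ω → Measure Ω} (hK : Measurable K)
    (hp : ∀ c, IsProbabilityMeasure (K c)) (ν : Measure Ω) [IsProbabilityMeasure ν] (n : ℕ) :
    IsProbabilityMeasure ((fun ρ : Measure Ω => ρ.bind K)^[n] ν) := by
  induction n with
  | zero => simpa
  | succ n ih =>
    rw [Function.iterate_succ_apply']
    exact isProbabilityMeasure_bind hK hp _

/-- The residual part of one step of a Markov chain that is minorized by `ε • δ`. -/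
theorem exists_bind_eq_add {K : Ω → Measure Ω} (hK : Measurable K)
    (hp : ∀ c, IsProbabilityMeasure (K c)) {δ : Measure Ω} [IsProbabilityMeasure δ] {ε : ℝ≥0∞}
    (hε : ∀ c, ε • δ ≤ K c) (ρ : Measure Ω) [IsFiniteMeasure ρ] (hε1 : ε ≤ 1) :
    ∃ ρ' : Measure Ω, IsFiniteMeasure ρ' ∧ ρ.bind K = (ε * ρ Set.univ) • δ + ρ' ∧
      ρ' Set.univ = (1 - ε) * ρ Set.univ := by
  have hfin : ε * ρ Set.univ ≠ ∞ :=
    ENNReal.mul_ne_top (ne_top_of_le_ne_top ENNReal.one_ne_top hε1) (measure_ne_top ρ _)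
  have huniv : ρ.bind K Set.univ = ρ Set.univ := by
    rw [Measure.bind_apply MeasurableSet.univ hK.aemeasurable]
    simp
  have hle : (ε * ρ Set.univ) • δ ≤ ρ.bind K := by
    refine Measure.le_iff.2 fun A hA => ?_
    rw [Measure.bind_apply hA hK.aemeasurable, Measure.smul_apply, smul_eq_mul]
    calc ε * ρ Set.univ * δ A = ∫⁻ _, ε * δ A ∂ρ := by rw [lintegral_const]; ring
      _ ≤ _ := lintegral_mono fun c => Measure.le_iff.1 (hε c) A hA
  have : IsFiniteMeasure (ρ.bind K) := ⟨by rw [huniv]; exact measure_lt_top ρ _⟩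
  have : IsFiniteMeasure ((ε * ρ Set.univ) • δ) := Measure.smul_finite δ hfin
  refine ⟨ρ.bind K - (ε * ρ Set.univ) • δ, inferInstance, ?_, ?_⟩
  · rw [add_comm, Measure.sub_add_cancel_of_le hle]
  · rw [Measure.sub_apply MeasurableSet.univ hle, huniv, Measure.smul_apply,
      measure_univ (μ := δ), smul_eq_mul, mul_one, ENNReal.sub_mul fun _ _ => measure_ne_top ρ _, one_mul]

/-- Two copies of a Markov chain that is minorized by `ε • δ` agree after `n` steps up to parts
of mass `(1 - ε) ^ n`. -/
theorem exists_common_part {K : Ω → Measure Ω} (hK : Measurable K)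
    (hp : ∀ c, IsProbabilityMeasure (K c)) {δ : Measure Ω} [IsProbabilityMeasure δ] {ε : ℝ≥0∞}
    (hε : ∀ c, ε • δ ≤ K c) (hε1 : ε ≤ 1) (ν ν' : Measure Ω) [IsProbabilityMeasure ν]
    [IsProbabilityMeasure ν'] (n : ℕ) :
    ∃ γ ρ ρ' : Measure Ω, IsFiniteMeasure ρ ∧ IsFiniteMeasure ρ' ∧
      (fun ρ : Measure Ω => ρ.bind K)^[n] ν = γ + ρ ∧
      (fun ρ : Measure Ω => ρ.bind K)^[n] ν' = γ + ρ' ∧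
      ρ Set.univ = (1 - ε) ^ n ∧ ρ' Set.univ = (1 - ε) ^ n := by
  induction n with
  | zero => exact ⟨0, ν, ν', inferInstance, inferInstance, by simp, by simp, by simp, by simp⟩
  | succ n ih =>
    obtain ⟨γ, ρ, ρ', _, _, h1, h2, m1, m2⟩ := ih
    obtain ⟨σ, f1, e1, w1⟩ := exists_bind_eq_add hK hp hε ρ hε1
    obtain ⟨σ', f2, e2, w2⟩ := exists_bind_eq_add hK hp hε ρ' hε1
    -- The two residual parts have equal mass, hence release the same multiple of `δ`, which joins
    -- the common part.
    refine ⟨γ.bind K + (ε * (1 - ε) ^ n) • δ, σ, σ', f1, f2, ?_, ?_, ?_, ?_⟩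
    · rw [Function.iterate_succ_apply', h1, add_bind hK, e1, m1, add_assoc]
    · rw [Function.iterate_succ_apply', h2, add_bind hK, e2, m2, add_assoc]
    · rw [w1, m1, pow_succ']
    · rw [w2, m2, pow_succ']

/-- The common part `γ` cancels, and the variation of a difference is at most the sum of the masses.
-/
theorem tvNorm_add_add_le (γ ρ ρ' : Measure Ω) [IsFiniteMeasure γ] [IsFiniteMeasure ρ]
    [IsFiniteMeasure ρ'] : tvNorm (γ + ρ) (γ + ρ') ≤ ρ Set.univ + ρ' Set.univ := by
  rw [tvNorm, dif_pos ⟨inferInstance, inferInstance⟩, Measure.toSignedMeasure_add,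
    Measure.toSignedMeasure_add, add_sub_add_left_eq_sub,
    SignedMeasure.totalVariation_eq_variation]
  have h := VectorMeasure.variation_sub_le (μ := ρ.toSignedMeasure) (ν := ρ'.toSignedMeasure)
  rw [Measure.variation_toSignedMeasure, Measure.variation_toSignedMeasure] at h
  exact h Set.univ

end Markov

/-! ### The sweep: invariance, minorization, convergence -/

section Sweep

variable {d q : ℕ} {a b : Fin d → ℝ} [NeZero d] [Nonempty (box a b)] {z T : ℝ}

theorem measurable_resamplePositions :
    Measurable (resamplePositions z T : Config q a b → Measure (Config q a b)) :=
  measurable_foldl_bind (measurable_resampleType z T) _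

theorem isProbabilityMeasure_resamplePositions (hz : 0 < z) (hT : 0 ≤ T) (c : Config q a b) :
    IsProbabilityMeasure (resamplePositions z T c) :=
  isProbabilityMeasure_foldl_bind (measurable_resampleType z T)
    (isProbabilityMeasure_resampleType hz hT) _ _

theorem measurable_sweep (hT : 0 ≤ T) :
    Measurable (sweep z T : Config q a b → Measure (Config q a b)) :=
  (Measure.measurable_bind' (measurable_drawEdgesAndChooseTypes hT)).comp
    measurable_resamplePositions

theorem isProbabilityMeasure_sweep (hz : 0 < z) (hT : 0 ≤ T) (c : Config q a b) :
    IsProbabilityMeasure (sweep z T c) := by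
  have := isProbabilityMeasure_resamplePositions hz hT c
  exact isProbabilityMeasure_bind (measurable_drawEdgesAndChooseTypes hT)
    (isProbabilityMeasure_drawEdgesAndChooseTypes hT) _

theorem isProbabilityMeasure_gibbs (hz : 0 < z) (hT : 0 ≤ T) :
    IsProbabilityMeasure (gibbs q a b z T) := by
  refine ⟨?_⟩
  rw [gibbs, Measure.smul_apply, smul_eq_mul]
  exact ENNReal.inv_mul_cancel gibbsUnnormalized_univ_ne_zero
    (gibbsUnnormalized_univ_lt_top hz hT).ne

theorem gibbs_bind_sweep (hz : 0 < z) (hT : 0 ≤ T) :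
    (gibbs q a b z T).bind (sweep z T) = gibbs q a b z T := by
  have h : (gibbsUnnormalized q a b z T).bind (sweep z T) = gibbsUnnormalized q a b z T := by
    have e : (gibbsUnnormalized q a b z T).bind (resamplePositions z T) =
        gibbsUnnormalized q a b z T :=
      (foldl_bind_eq (measurable_resampleType z T) _ _).trans
        (foldl_bind_of_invariant (gibbsUnnormalized_bind_resampleType hz hT) _)
    have e2 := Measure.bind_bind (m := gibbsUnnormalized q a b z T)
      (measurable_resamplePositions (z := z) (T := T)).aemeasurable
      (measurable_drawEdgesAndChooseTypes hT).aemeasurable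
    rw [e, gibbsUnnormalized_bind_draw hz hT] at e2
    exact e2.symm
  rw [gibbs, Measure.bind_smul, h]

/-- Types emptied earlier stay empty while a further one is resampled, so each resampling costs one
more factor. -/
theorem le_foldl_resampleType (hz : 0 < z) (hT : 0 ≤ T) (l : List (Fin q)) (c : Config q a b) :
    ENNReal.ofReal (Real.exp (-(z * volume.real (box a b)))) ^ l.length ≤
      l.foldl (fun ν s => ν.bind (resampleType z T s)) (Measure.dirac c)
        {c' | ∀ s ∈ l.toFinset, (c'.1 s).pts = ∅} := by
  induction l using List.reverseRecOn with
  | nil => simp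
  | append_singleton l s ih =>
    simp only [List.foldl_append, List.foldl_cons, List.foldl_nil, List.length_append,
      List.length_singleton, pow_succ']
    have hA := measurableSet_empty_types (a := a) (b := b) (l ++ [s]).toFinset
    have hB := measurableSet_empty_types (a := a) (b := b) l.toFinset
    rw [Measure.bind_apply hA (measurable_resampleType z T s).aemeasurable]
    refine (mul_le_mul_right ih _).trans ?_
    rw [← lintegral_indicator_const hB]
    refine lintegral_mono fun c' => ?_
    by_cases hc : ∀ t ∈ l.toFinset, (c'.1 t).pts = ∅
    · rw [Set.indicator_of_mem (by exact hc)]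
      refine le_resampleType hz hT hA fun c'' h1 h2 t ht => ?_
      by_cases hts : t = s
      · rw [hts, h1]
      · rw [h2 t hts]
        exact hc t (by simpa [hts] using ht)
    · rw [Set.indicator_of_notMem (by exact hc)]
      exact zero_le

/-- The configuration without particles. -/
def emptyConfig : Config q a b := ⟨fun _ => ⟨∅⟩, fun _ _ _ => Finset.disjoint_empty_left _⟩

/-- All `q` types become empty with probability at least the `q`-th power of `exp (-z|Λ|)`, and an
empty configuration has nothing to recolor. -/
theorem smul_dirac_le_sweep (hz : 0 < z) (hT : 0 ≤ T) (c : Config q a b) :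
    ENNReal.ofReal (Real.exp (-(z * q * volume.real (box a b)))) • Measure.dirac emptyConfig ≤
      sweep z T c := by
  refine Measure.le_iff.2 fun A hA => ?_
  rw [Measure.smul_apply, smul_eq_mul, Measure.dirac_apply' _ hA]
  by_cases h0 : emptyConfig ∈ A
  swap
  · simp [h0]
  rw [Set.indicator_of_mem h0, Pi.one_apply, mul_one]
  have hB := measurableSet_empty_types (q := q) (a := a) (b := b) Finset.univ
  have hsub : {c' : Config q a b | ∀ s ∈ Finset.univ, (c'.1 s).pts = ∅} ⊆ A := by
    intro c' hc'
    have : c' = emptyConfig := by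
      apply Subtype.ext
      funext s
      ext1
      exact hc' s (Finset.mem_univ s)
    rwa [this]
  refine le_trans ?_ (measure_mono hsub)
  have h1 := le_foldl_resampleType hz hT (List.finRange q) c
  rw [List.toFinset_finRange, List.length_finRange, ← ENNReal.ofReal_pow (Real.exp_pos _).le,
    ← Real.exp_nat_mul] at h1
  rw [show -(z * q * volume.real (box a b)) = q * -(z * volume.real (box a b)) by ring]
  refine h1.trans ?_
  rw [sweep, Measure.bind_apply hB (measurable_drawEdgesAndChooseTypes hT).aemeasurable,
    ← lintegral_indicator_one hB]
  refine lintegral_mono fun c' => ?_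
  by_cases hc : ∀ s ∈ Finset.univ, (c'.1 s).pts = ∅
  · rw [drawEdgesAndChooseTypes_empty hT fun s => hc s (Finset.mem_univ s),
      Set.indicator_of_mem (by exact hc)]
    exact le_rfl
  · rw [Set.indicator_of_notMem (by exact hc)]
    exact zero_le

theorem tvNorm_lawAfter_le (hz : 0 < z) (hT : 0 ≤ T) (ν : Measure (Config q a b))
    [IsProbabilityMeasure ν] (n : ℕ) :
    tvNorm (lawAfter z T ν n) (gibbs q a b z T) ≤
      2 * ENNReal.ofReal ((1 - Real.exp (-(z * q * volume.real (box a b)))) ^ n) := by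
  have := isProbabilityMeasure_gibbs (q := q) (a := a) (b := b) hz hT
  have hexp : Real.exp (-(z * q * volume.real (box a b))) ≤ 1 := by
    rw [Real.exp_le_one_iff]
    have : 0 ≤ z * q * volume.real (box a b) := by positivity
    linarith
  obtain ⟨γ, ρ, ρ', _, _, h1, h2, m1, m2⟩ := exists_common_part (measurable_sweep hT)
    (isProbabilityMeasure_sweep hz hT) (smul_dirac_le_sweep hz hT)
    (ENNReal.ofReal_le_one.2 hexp) ν (gibbs q a b z T) n
  -- The second copy starts in equilibrium, so by invariance it still has the Gibbs law after `n`
  -- sweeps.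
  rw [Function.iterate_fixed (gibbs_bind_sweep hz hT)] at h2
  have : IsFiniteMeasure γ := by
    refine isFiniteMeasure_of_le (gibbs q a b z T) ?_
    rw [h2]
    exact Measure.le_add_right le_rfl
  rw [lawAfter, h1, h2]
  refine (tvNorm_add_add_le γ ρ ρ').trans ?_
  rw [m1, m2, ← two_mul, ENNReal.ofReal_pow (by linarith), ENNReal.ofReal_sub _ (Real.exp_pos _).le,
    ENNReal.ofReal_one]

end Sweep

end ContinuumPotts

end

theorem mainTheorem3 {d q : ℕ} (hd : 2 ≤ d) (hq : 2 ≤ q) (a b : Fin d → ℝ)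
    (hab : ∀ i, a i < b i) (z T : ℝ) (hz : 0 < z) (hT : 0 ≤ T) :
    IsProbabilityMeasure (ContinuumPotts.gibbs q a b z T) ∧
    Measurable (ContinuumPotts.sweep z T :
      ContinuumPotts.Config q a b → Measure (ContinuumPotts.Config q a b)) ∧
    (∀ c : ContinuumPotts.Config q a b, IsProbabilityMeasure (ContinuumPotts.sweep z T c)) ∧
    (ContinuumPotts.gibbs q a b z T).bind (ContinuumPotts.sweep z T) =
      ContinuumPotts.gibbs q a b z T ∧
    ∀ (ν : Measure (ContinuumPotts.Config q a b)) [IsProbabilityMeasure ν] (n : ℕ),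
      IsProbabilityMeasure (ContinuumPotts.lawAfter z T ν n) ∧
      ContinuumPotts.tvNorm (ContinuumPotts.lawAfter z T ν n) (ContinuumPotts.gibbs q a b z T) ≤
        2 * ENNReal.ofReal
          ((1 - Real.exp (-(z * q * volume.real (ContinuumPotts.box a b)))) ^ n) := by
  have : NeZero d := ⟨by omega⟩
  have := ContinuumPotts.nonempty_box hab
  exact ⟨ContinuumPotts.isProbabilityMeasure_gibbs hz hT, ContinuumPotts.measurable_sweep hT,
    ContinuumPotts.isProbabilityMeasure_sweep hz hT, ContinuumPotts.gibbs_bind_sweep hz hT,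
    fun ν _ n => ⟨ContinuumPotts.isProbabilityMeasure_iterate_bind
      (ContinuumPotts.measurable_sweep hT) (ContinuumPotts.isProbabilityMeasure_sweep hz hT) ν n,
      ContinuumPotts.tvNorm_lawAfter_le hz hT ν n⟩⟩
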